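/- All Banach spaces and Banach lattices are real. For a Banach lattice $X$, let $\mathrm{Hom}(X,\mathbb{R})$ be the set of all bounded linear functionals $x^*$ on $X$ with $x^*(x\vee y)=x^*(x)\vee x^*(y)$ and $x^*(x\wedge y)=x^*(x)\wedge x^*(y)$ for all $x,y\in X$. For a compact Hausdorff space $K$, let $C(K,X)$ be the Banach lattice of all continuous functions from $K$ to $X$, with the supremum norm and the pointwise order. (1) Let $X$ be a Banach lattice such that $\mathrm{Hom}(X,\mathbb{R})=\{0\}$, and let $K$ be a compact Hausdorff space. Then $\mathrm{Hom}(C(K,X),\mathbb{R})=\{0\}$. (2) In particular, every separable Banach lattice embeds lattice-isometrically into a Banach lattice on which there are no nonzero real lattice homomorphisms. More precisely, let $\Delta$ be the Cantor set and let $L_1[0,1]$ be taken with respect to Lebesgue measure. Then $C(\Delta,L_1[0,1])$ is a Banach lattice with $\mathrm{Hom}(C(\Delta,L_1[0,1]),\mathbb{R})=\{0\}$, and for every separable Banach lattice $X$ there is a linear isometry $T\colon X\to C(\Delta,L_1[0,1])$ with $T(x\vee y)=Tx\vee Ty$ and $T(x\wedge y)=Tx\wedge Ty$ for all $x,y\in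 X$. -/

import Mathlib

open MeasureTheory

universe u v w

/-- A (real) Banach lattice: a complete real normed space with a lattice order which is compatible
with the vector space operations and whose norm is solid (`|x| ≤ |y| → ‖x‖ ≤ ‖y‖`). -/
class IsBanachLattice (X : Type u) [NormedAddCommGroup X] [NormedSpace ℝ X] [Lattice X] : Prop
    extends CompleteSpace X, HasSolidNorm X, IsOrderedAddMonoid X, IsOrderedModule ℝ X

/-- A bounded linear operator between Banach lattices is a lattice homomorphism if it preserves
binary suprema and infima. -/
def IsLatticeHomomorphism {X : Type u} {Y : Type v} [NormedAddCommGroup X] [NormedSpace ℝ X]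
    [Lattice X] [NormedAddCommGroup Y] [NormedSpace ℝ Y] [Lattice Y] (T : X →L[ℝ] Y) : Prop :=
  (∀ x y : X, T (x ⊔ y) = T x ⊔ T y) ∧ (∀ x y : X, T (x ⊓ y) = T x ⊓ T y)

/-- `Hom(X, ℝ)`: the set of all functionals in the dual of `X` that are lattice homomorphisms. -/
def RealLatticeHom (X : Type u) [NormedAddCommGroup X] [NormedSpace ℝ X] [Lattice X] :
    Set (X →L[ℝ] ℝ) :=
  {φ | IsLatticeHomomorphism φ}

/-- A linear isometry which preserves the lattice operations. -/
def IsLatticeIsometricEmbedding {X : Type u} {Y : Type v} [NormedAddCommGroup X] [NormedSpace ℝ X]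
    [Lattice X] [NormedAddCommGroup Y] [NormedSpace ℝ Y] [Lattice Y] (T : X →L[ℝ] Y) : Prop :=
  Isometry T ∧ IsLatticeHomomorphism T

/-- The space `C(K, X)`, with Mathlib's supremum norm and pointwise order, is a Banach lattice. -/
instance ContinuousMap.isBanachLattice (K : Type v) [TopologicalSpace K] [CompactSpace K]
    (X : Type u) [NormedAddCommGroup X] [NormedSpace ℝ X] [Lattice X] [IsBanachLattice X] :
    IsBanachLattice C(K, X) where
  toCompleteSpace := inferInstance
  solid := by
    intro f g h
    refine (ContinuousMap.norm_le f (norm_nonneg g)).2 fun t => ?_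
    have ht : |f t| ≤ |g t| := h t
    exact (HasSolidNorm.solid ht).trans (g.norm_coe_le_norm t)
  add_le_add_left := fun f g h k t => add_le_add_left (h t) (k t)
  smul_le_smul_of_nonneg_left := fun a ha f g h t =>
    smul_le_smul_of_nonneg_left (h t) ha
  smul_le_smul_of_nonneg_right := fun f hf a b h t =>
    smul_le_smul_of_nonneg_right h (hf t)

/-- The Banach lattice `L₁[0,1]` for Lebesgue measure, with the norm `∫ |f|` and the almost
everywhere order. -/
abbrev L1Interval : Type := Lp ℝ 1 (volume.restrict (Set.Icc (0 : ℝ) 1))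

instance L1Interval.isBanachLattice : IsBanachLattice L1Interval where
  toCompleteSpace := inferInstance
  solid := HasSolidNorm.solid
  add_le_add_left := fun _ _ h _ => add_le_add_left h _
  smul_le_smul_of_nonneg_left := by
    intro a ha f g h
    rw [← Lp.coeFn_le] at h ⊢
    filter_upwards [Lp.coeFn_smul a f, Lp.coeFn_smul a g, h] with x h1 h2 h3
    rw [h1, h2]
    exact smul_le_smul_of_nonneg_left h3 ha
  smul_le_smul_of_nonneg_right := by
    intro f hf a b h
    rw [← Lp.coeFn_nonneg] at hf
    rw [← Lp.coeFn_le]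
    filter_upwards [Lp.coeFn_smul a f, Lp.coeFn_smul b f, hf] with x h1 h2 h3
    rw [h1, h2]
    exact smul_le_smul_of_nonneg_right h h3

/-- The Cantor set is compact. -/
instance cantorSet.instCompactSpace : CompactSpace cantorSet :=
  isCompact_iff_compactSpace.1 isCompact_cantorSet

/-- The Banach lattice `C(Δ, L₁[0,1])`, where `Δ` is the Cantor set. -/
abbrev CantorL1 : Type := C(cantorSet, L1Interval)

/-! Part (1) is localization. If no point of `K` supported `φ`, compactness would give finitely many
`F i` with `φ (F i) ≠ 0` and `⨅ |F i| = 0`, whereas `φ` maps this infimum to `min |φ (F i)| > 0`. So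
`φ F` depends only on the value of `F` at one point, and restricting `φ` to constants gives a
homomorphism on `X`. On `L₁[0,1]` only zero exists: the truncations of `f ≥ 0` to `(-∞, t]` run
continuously from `0` to `f`, each disjoint from its complement in `f`, so `φ` takes at most the two
values `0` and `φ f` along a connected path.

For the embedding, let `V` be the vector sublattice generated by a dense sequence and an element `e`
whose principal ideal contains it. Yosida's theorem embeds `V` in `C(Δ)` by a lattice homomorphism
`J` with `J e = 1` (`exists_cantorSet_representation`). The positive functionals `ν` with `ν (J y) ≤
‖y‖` form a weak* compact metrizable set, hence a continuous image of `Δ`, and by Hahn–Banach `‖x‖ =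
max ν_z |J x|` (`exists_cantorSet_norming_family`).

Each `ν_z` is integration of `f ∘ q_z` over `[0,1]`, where `q_z` is a quantile function. Then `f ↦
(z ↦ f ∘ q_z)` preserves suprema and `‖f ∘ q_z‖₁ = ν_z |f|`. Weak* continuity in `z` becomes `L₁`
continuity, since for `f` the indicator of an initial segment `f ∘ q_z` is the indicator of `s ≤ ν_z
f`, and such `f` span a dense subspace (`exists_latticeHom_L1_of_family`). Composing with `J` and
extending from `V` by density gives the embedding. -/

theorem zero_mem_realLatticeHom (X : Type u) [NormedAddCommGroup X] [NormedSpace ℝ X] [Lattice X] :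
    (0 : X →L[ℝ] ℝ) ∈ RealLatticeHom X :=
  ⟨fun _ _ => by simp, fun _ _ => by simp⟩

theorem realLatticeHom_eq_zero_iff {X : Type u} [NormedAddCommGroup X] [NormedSpace ℝ X]
    [Lattice X] : RealLatticeHom X = {0} ↔ ∀ φ ∈ RealLatticeHom X, φ = 0 :=
  ⟨fun h φ hφ => by simpa [h] using hφ,
    fun h => Set.Subset.antisymm h (by simpa using zero_mem_realLatticeHom X)⟩

theorem IsLatticeHomomorphism.map_abs {X : Type u} {Y : Type v} [NormedAddCommGroup X]
    [NormedSpace ℝ X] [Lattice X] [NormedAddCommGroup Y] [NormedSpace ℝ Y] [Lattice Y]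
    {T : X →L[ℝ] Y} (hT : IsLatticeHomomorphism T) (x : X) : T |x| = |T x| := by
  rw [abs, hT.1, map_neg, abs]

/-! ### Localization of real lattice homomorphisms on `C(K, X)` -/

/-- A continuous function vanishing at `t` is a uniform limit of functions vanishing near `t`. -/
theorem exists_eventually_zero_near {X : Type u} [NormedAddCommGroup X] [NormedSpace ℝ X]
    {K : Type v} [TopologicalSpace K] [CompactSpace K] (F : C(K, X)) {t : K} (ht : F t = 0) {ε : ℝ} (hε : 0 < ε) :
    ∃ G : C(K, X), (∀ᶠ s in nhds t, G s = 0) ∧ ‖F - G‖ ≤ ε := by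
  -- Soft threshold: `c s • F s` shortens `F s` by `ε`, and is zero where the norm is at most `ε`.
  -- The `max` in the denominator keeps it nonzero.
  let c : C(K, ℝ) := ⟨fun s => max (‖F s‖ - ε) 0 / max ‖F s‖ ε, by
    refine Continuous.div (by fun_prop) (by fun_prop) fun s => ?_
    exact (lt_max_of_lt_right hε).ne'⟩
  refine ⟨⟨fun s => c s • F s, by fun_prop⟩, ?_, ?_⟩
  · have : ∀ᶠ s in nhds t, ‖F s‖ < ε :=
      (F.continuous.norm.tendsto t).eventually_lt_const (by simpa [ht] using hε)
    filter_upwards [this] with s hs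
    have : c s = 0 := by
      simp only [c, ContinuousMap.coe_mk]
      rw [max_eq_right (by linarith), zero_div]
    simp [this]
  · refine (ContinuousMap.norm_le _ hε.le).2 fun s => ?_
    have h1 : (F - ⟨fun s => c s • F s, by fun_prop⟩ : C(K, X)) s = (1 - c s) • F s := by
      simp [sub_smul]
    rw [h1, norm_smul, Real.norm_eq_abs]
    simp only [c, ContinuousMap.coe_mk]
    rcases le_total ‖F s‖ ε with h | h
    · rw [max_eq_right (by linarith : ‖F s‖ - ε ≤ 0)]
      simpa using h
    · rw [max_eq_left (by linarith : 0 ≤ ‖F s‖ - ε), max_eq_left h]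
      have hp : 0 < ‖F s‖ := hε.trans_le h
      have : 1 - (‖F s‖ - ε) / ‖F s‖ = ε / ‖F s‖ := by field_simp; ring
      rw [this, abs_of_pos (by positivity)]
      exact (div_mul_cancel₀ _ hp.ne').le

section Localization

variable {X : Type u} [NormedAddCommGroup X] [NormedSpace ℝ X] [Lattice X] [IsBanachLattice X]
  {K : Type v} [TopologicalSpace K] [CompactSpace K]

/-- A real lattice homomorphism on `C(K, X)` is supported at a point. -/
theorem exists_point_of_realLatticeHom [Nonempty K] {φ : C(K, X) →L[ℝ] ℝ}
    (hφ : φ ∈ RealLatticeHom C(K, X)) :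
    ∃ t : K, ∀ F : C(K, X), (∀ᶠ s in nhds t, F s = 0) → φ F = 0 := by
  by_contra! h
  choose F hF hφF using h
  obtain ⟨s, -, hs⟩ := isCompact_univ.elim_nhds_subcover (fun t => {r | F t r = 0})
    (fun t _ => hF t)
  have hne : s.Nonempty := by
    obtain ⟨t⟩ := ‹Nonempty K›
    have := hs (Set.mem_univ t)
    simp only [Set.mem_iUnion] at this
    obtain ⟨i, hi, -⟩ := this
    exact ⟨i, hi⟩
  have key : ∀ (s : Finset K) (hs : s.Nonempty), 0 < φ (s.inf' hs fun t => |F t|) := by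
    intro s hs
    induction hs using Finset.Nonempty.cons_induction with
    | singleton a =>
      simp only [Finset.inf'_singleton, hφ.map_abs]
      exact abs_pos.2 (hφF a)
    | cons a s ha hs ih =>
      rw [Finset.inf'_cons hs, hφ.2, hφ.map_abs]
      exact lt_min (abs_pos.2 (hφF a)) ih
  have hzero : s.inf' hne (fun t => |F t|) = 0 := by
    refine le_antisymm ?_ (Finset.le_inf' _ _ fun i _ => abs_nonneg _)
    intro r
    have hr := hs (Set.mem_univ r)
    simp only [Set.mem_iUnion] at hr
    obtain ⟨i, hi, hir⟩ := hr
    have h1 : s.inf' hne (fun t => |F t|) ≤ |F i| := Finset.inf'_le _ hi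
    refine (h1 r).trans ?_
    have h2 : F i r = 0 := hir
    change |F i r| ≤ 0
    simp [h2]
  have := key s hne
  rw [hzero, map_zero] at this
  exact lt_irrefl _ this

/-- A real lattice homomorphism on `C(K, X)` factors through evaluation at a point. -/
theorem exists_eq_comp_eval_of_realLatticeHom [Nonempty K] {φ : C(K, X) →L[ℝ] ℝ}
    (hφ : φ ∈ RealLatticeHom C(K, X)) :
    ∃ t : K, ∀ F : C(K, X), φ F = φ (ContinuousMap.const K (F t)) := by
  obtain ⟨t, ht⟩ := exists_point_of_realLatticeHom hφ
  have hz : ∀ F : C(K, X), F t = 0 → φ F = 0 := by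
    intro F hF
    by_contra hne
    have hpos : 0 < |φ F| := abs_pos.2 hne
    -- Adding `1` avoids division by zero and makes the final estimate strictly smaller than `|φ
    -- F|`.
    have hM : 0 < ‖φ‖ + 1 := by positivity
    obtain ⟨G, hG, hFG⟩ := exists_eventually_zero_near F hF
      (div_pos hpos hM)
    have h1 : ‖φ (F - G)‖ ≤ ‖φ‖ * (|φ F| / (‖φ‖ + 1)) :=
      (φ.le_opNorm _).trans (mul_le_mul_of_nonneg_left hFG (norm_nonneg _))
    rw [map_sub, ht G hG, sub_zero, Real.norm_eq_abs, mul_div_assoc', le_div_iff₀ hM] at h1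
    nlinarith
  refine ⟨t, fun F => ?_⟩
  have := hz (F - ContinuousMap.const K (F t)) (by simp)
  rwa [map_sub, sub_eq_zero] at this

theorem realLatticeHom_continuousMap_eq_zero (h : RealLatticeHom X = {0}) :
    RealLatticeHom C(K, X) = {0} := by
  rw [realLatticeHom_eq_zero_iff] at h ⊢
  intro φ hφ
  cases isEmpty_or_nonempty K with
  | inl hK =>
    ext F
    rw [Subsingleton.elim F 0]
    simp
  | inr hK =>
    obtain ⟨t, ht⟩ := exists_eq_comp_eval_of_realLatticeHom hφ
    let ι : X →L[ℝ] C(K, X) := LinearMap.mkContinuous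
      { toFun := fun x => ContinuousMap.const K x
        map_add' := fun _ _ => rfl
        map_smul' := fun _ _ => rfl } 1 fun x => by
          rw [one_mul]
          exact (ContinuousMap.norm_le _ (norm_nonneg _)).2 fun _ => le_rfl
    have hι : φ.comp ι = 0 := h _ ⟨fun x y => hφ.1 (ι x) (ι y), fun x y => hφ.2 (ι x) (ι y)⟩
    ext F
    rw [ht F]
    exact DFunLike.congr_fun hι (F t)

end Localization

/-! ### Absence of real lattice homomorphisms on `L₁[0,1]` -/

/-- Dominated convergence: as `s → t`, pointwise convergence of the truncations can fail only at `x
= t`, a null set because there are no atoms. -/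
theorem continuous_indicator_Iic_toLp {μ : Measure ℝ} [NullSingletonClass μ] {f : ℝ → ℝ}
    (hf : Integrable f μ) :
    Continuous fun t : ℝ => (hf.indicator (measurableSet_Iic (a := t))).toL1 := by
  rw [continuous_iff_continuousAt]
  intro t
  rw [ContinuousAt, tendsto_iff_norm_sub_tendsto_zero]
  have hdom := tendsto_integral_filter_of_dominated_convergence (μ := μ) (l := nhds t)
    (F := fun s x => ‖(Set.Iic s).indicator f x - (Set.Iic t).indicator f x‖)
    (f := fun _ => (0 : ℝ)) (fun x => ‖f x‖)
    (Filter.Eventually.of_forall fun s => ((hf.indicator measurableSet_Iic).sub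
      (hf.indicator measurableSet_Iic)).norm.aestronglyMeasurable)
    (Filter.Eventually.of_forall fun s => Filter.Eventually.of_forall fun x => by
      by_cases h1 : x ∈ Set.Iic s <;> by_cases h2 : x ∈ Set.Iic t <;> simp [h1, h2])
    hf.norm ?_
  · rw [integral_zero] at hdom
    refine hdom.congr fun s => ?_
    rw [← Integrable.toL1_sub, L1.norm_eq_integral_norm]
    refine integral_congr_ae ?_
    filter_upwards [Integrable.coeFn_toL1 ((hf.indicator (measurableSet_Iic (a := s))).sub
      (hf.indicator (measurableSet_Iic (a := t))))] with x hx
    rw [hx, Pi.sub_apply]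
  · have : ∀ᵐ x ∂μ, x ≠ t := by simp [ae_iff, measure_singleton]
    filter_upwards [this] with x hx
    refine tendsto_const_nhds.congr' ?_
    rcases lt_or_gt_of_ne hx with h | h
    · filter_upwards [lt_mem_nhds h] with s hs
      simp [Set.indicator, h.le, (show x < s from hs).le]
    · filter_upwards [gt_mem_nhds h] with s hs
      simp [Set.indicator, not_le.2 h, not_le.2 (show s < x from hs)]

theorem realLatticeHom_L1Interval_eq_zero : RealLatticeHom L1Interval = {0} := by
  rw [realLatticeHom_eq_zero_iff]
  intro φ hφ
  set μ := (volume.restrict (Set.Icc (0 : ℝ) 1)) with hμ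
  have hpos : ∀ f : L1Interval, 0 ≤ f → φ f = 0 := by
    intro f hf
    have hfi : Integrable f μ := L1.integrable_coeFn f
    let g : ℝ → L1Interval := fun t => (hfi.indicator (measurableSet_Iic (a := t))).toL1
    have hg : Continuous g := continuous_indicator_Iic_toLp hfi
    have hf' : ∀ᵐ x ∂μ, 0 ≤ f x := by
      have := (Lp.coeFn_nonneg f).2 hf
      exact this
    have h0 : g (-1) = 0 := by
      rw [Lp.ext_iff]
      filter_upwards [Integrable.coeFn_toL1 (hfi.indicator (measurableSet_Iic (a := (-1 : ℝ)))),
        Lp.coeFn_zero ℝ 1 μ, ae_restrict_mem measurableSet_Icc] with x h1 h2 h3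
      rw [h1, h2]
      have : ¬ x ≤ -1 := by have := h3.1; linarith
      simp [Set.indicator, this]
    have h1 : g 1 = f := by
      rw [Lp.ext_iff]
      filter_upwards [Integrable.coeFn_toL1 (hfi.indicator (measurableSet_Iic (a := (1 : ℝ)))),
        ae_restrict_mem measurableSet_Icc] with x h1 h3
      rw [h1]
      simp [Set.indicator, h3.2]
    -- Disjointness forces `min (φ (g t)) (φ f - φ (g t)) = 0`; the intermediate value `φ f / 2` is
    -- then impossible unless `φ f = 0`.
    have hdisj : ∀ t, g t ⊓ (f - g t) = 0 := by
      intro t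
      rw [Lp.ext_iff]
      filter_upwards [Integrable.coeFn_toL1 (hfi.indicator (measurableSet_Iic (a := t))),
        Lp.coeFn_zero ℝ 1 μ, Lp.coeFn_inf (g t) (f - g t), Lp.coeFn_sub f (g t), hf']
        with x h1 h2 h3 h4 h5
      rw [h3, h2, Pi.inf_apply, h4, Pi.sub_apply, h1]
      by_cases h : x ∈ Set.Iic t <;> simp [h, h5]
    have hval : ∀ t, φ (g t) = 0 ∨ φ (g t) = φ f := by
      intro t
      have := congrArg φ (hdisj t)
      rw [hφ.2, map_sub, map_zero] at this
      rcases min_choice (φ (g t)) (φ f - φ (g t)) with h | h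
      · left; rw [← h]; exact this
      · right
        have h' : φ f - φ (g t) = 0 := by rw [← h]; exact this
        linarith
    by_contra hne
    have hc : Continuous fun t => φ (g t) := φ.continuous.comp hg
    have hmem : φ f / 2 ∈ Set.range fun t => φ (g t) :=
      mem_range_of_exists_le_of_exists_ge hc (c := φ f / 2)
        (by
          rcases lt_or_gt_of_ne hne with h | h
          · exact ⟨1, by simp only [h1]; linarith⟩
          · exact ⟨-1, by simp only [h0, map_zero]; linarith⟩)
        (by
          rcases lt_or_gt_of_ne hne with h | h
          · exact ⟨-1, by simp only [h0, map_zero]; linarith⟩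
          · exact ⟨1, by simp only [h1]; linarith⟩)
    obtain ⟨t, ht⟩ := hmem
    simp only at ht
    rcases hval t with h | h
    · exact hne (by linarith)
    · exact hne (by linarith)
  ext f
  have h1 := hpos |f| (abs_nonneg f)
  rw [hφ.map_abs, abs_eq_zero] at h1
  simpa using h1

/-! ### Yosida's theorem through minimal sup-preserving sublinear functionals -/

section Yosida

variable {V : Type w} [AddCommGroup V] [Lattice V] [Module ℝ V]

/-- Monotone sublinear functionals which preserve binary suprema. The linear ones are the real
lattice homomorphisms. -/
structure IsMaxSublinear (p : V → ℝ) : Prop where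
  mono : Monotone p
  add_le : ∀ x y, p (x + y) ≤ p x + p y
  smul_le : ∀ c : ℝ, 0 ≤ c → ∀ x, p (c • x) ≤ c * p x
  sup_le : ∀ x y, p (x ⊔ y) ≤ max (p x) (p y)

namespace IsMaxSublinear

variable {p : V → ℝ}

theorem map_zero (hp : IsMaxSublinear p) : p 0 = 0 := by
  have h1 := hp.smul_le 0 le_rfl 0
  have h2 := hp.add_le 0 0
  simp only [smul_zero, zero_mul, add_zero] at h1 h2
  linarith

theorem neg_le (hp : IsMaxSublinear p) (x : V) : -p (-x) ≤ p x := by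
  have := hp.add_le x (-x)
  rw [add_neg_cancel, hp.map_zero] at this
  linarith

theorem smul_eq (hp : IsMaxSublinear p) {c : ℝ} (hc : 0 ≤ c) (x : V) : p (c • x) = c * p x := by
  refine le_antisymm (hp.smul_le c hc x) ?_
  rcases hc.eq_or_lt with rfl | hc'
  · simp [hp.map_zero]
  · have := hp.smul_le c⁻¹ (inv_nonneg.2 hc) (c • x)
    rw [inv_smul_smul₀ hc'.ne', inv_mul_eq_div, le_div_iff₀ hc'] at this
    linarith

theorem map_sup (hp : IsMaxSublinear p) (x y : V) : p (x ⊔ y) = max (p x) (p y) :=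
  le_antisymm (hp.sup_le x y) (max_le (hp.mono le_sup_left) (hp.mono le_sup_right))

/-- The hypotheses only ask that one index do the work of two, which covers both chains and families
decreasing in a real parameter. -/
theorem iInf {ι : Type*} [Nonempty ι] {f : ι → V → ℝ} (hb : ∀ x, BddBelow (Set.range fun i => f i x))
    (hmono : ∀ i, Monotone (f i))
    (hadd : ∀ i j x y, ∃ k, f k (x + y) ≤ f i x + f j y)
    (hsmul : ∀ i (c : ℝ), 0 ≤ c → ∀ x, ∃ k, f k (c • x) ≤ c * f i x)
    (hsup : ∀ i j x y, ∃ k, f k (x ⊔ y) ≤ max (f i x) (f j y)) :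
    IsMaxSublinear fun x => ⨅ i, f i x where
  mono x y h := ciInf_mono (hb x) fun i => hmono i h
  add_le x y := by
    refine le_ciInf_add_ciInf fun i j => ?_
    obtain ⟨k, hk⟩ := hadd i j x y
    exact (ciInf_le (hb _) k).trans hk
  smul_le c hc x := by
    rw [Real.mul_iInf_of_nonneg hc]
    refine le_ciInf fun i => ?_
    obtain ⟨k, hk⟩ := hsmul i c hc x
    exact (ciInf_le (hb _) k).trans hk
  sup_le x y := by
    refine le_of_forall_pos_lt_add fun ε hε => ?_
    obtain ⟨i, hi⟩ := exists_lt_of_ciInf_lt (lt_add_of_pos_right (⨅ i, f i x) hε)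
    obtain ⟨j, hj⟩ := exists_lt_of_ciInf_lt (lt_add_of_pos_right (⨅ i, f i y) hε)
    obtain ⟨k, hk⟩ := hsup i j x y
    refine ((ciInf_le (hb _) k).trans hk).trans_lt ?_
    rw [max_add]
    exact max_lt_max hi hj

/-- The infimum of a nonempty chain. -/
theorem iInf_chain {c : Set (V → ℝ)} (hne : c.Nonempty) (hc : IsChain (· ≤ ·) c)
    (hp : ∀ p ∈ c, IsMaxSublinear p) (hb : ∀ x, BddBelow (Set.range fun p : c => p.1 x)) :
    IsMaxSublinear fun x => ⨅ p : c, p.1 x := by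
  have : Nonempty c := hne.to_subtype
  refine iInf hb (fun i => (hp _ i.2).mono) (fun i j x y => ?_)
    (fun i a ha x => ⟨i, (hp _ i.2).smul_le a ha x⟩) (fun i j x y => ?_)
  · rcases hc.total i.2 j.2 with h | h
    · exact ⟨i, ((hp _ i.2).add_le x y).trans (by gcongr; exact h y)⟩
    · exact ⟨j, ((hp _ j.2).add_le x y).trans (by gcongr; exact h x)⟩
  · rcases hc.total i.2 j.2 with h | h
    · exact ⟨i, ((hp _ i.2).sup_le x y).trans (max_le_max le_rfl (h y))⟩
    · exact ⟨j, ((hp _ j.2).sup_le x y).trans (max_le_max (h x) le_rfl)⟩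

variable [IsOrderedAddMonoid V]

/-- The one-sided directional modification of `p` in direction `x`. -/
theorem exists_le_neg (hp : IsMaxSublinear p) (x : V) :
    ∃ q : V → ℝ, IsMaxSublinear q ∧ q ≤ p ∧ q (-x) ≤ -p x := by
  -- By subadditivity `f t z` decreases in `t`, so the larger of two parameters serves both
  -- arguments of a supremum. The choice `t = 1`, `z = -x` gives the bound `-p x`.
  let f : {t : ℝ // 0 ≤ t} → V → ℝ := fun t z => p (z + t.1 • x) - t.1 * p x
  have hb : ∀ z, BddBelow (Set.range fun t => f t z) := by
    intro z
    refine ⟨-p (-z), ?_⟩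
    rintro _ ⟨⟨t, ht⟩, rfl⟩
    have := hp.add_le (z + t • x) (-z)
    rw [show z + t • x + -z = t • x by abel, hp.smul_eq ht] at this
    simp only [f]
    linarith
  have hanti : ∀ (s t : {t : ℝ // 0 ≤ t}) z, s.1 ≤ t.1 → f t z ≤ f s z := by
    intro s t z h
    have h1 := hp.add_le (z + s.1 • x) ((t.1 - s.1) • x)
    rw [hp.smul_eq (sub_nonneg.2 h), show z + s.1 • x + (t.1 - s.1) • x = z + t.1 • x by
      rw [sub_smul]; abel] at h1
    simp only [f]
    linarith
  have hmono : ∀ t, Monotone (f t) := by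
    intro t y z h
    simp only [f]
    gcongr
    exact hp.mono (by gcongr)
  have : Nonempty {t : ℝ // 0 ≤ t} := ⟨⟨0, le_rfl⟩⟩
  refine ⟨fun z => ⨅ t, f t z, iInf hb hmono ?_ ?_ ?_, ?_, ?_⟩
  · intro s t y z
    refine ⟨⟨s.1 + t.1, add_nonneg s.2 t.2⟩, ?_⟩
    have h1 := hp.add_le (y + s.1 • x) (z + t.1 • x)
    rw [show y + s.1 • x + (z + t.1 • x) = y + z + (s.1 + t.1) • x by rw [add_smul]; abel] at h1
    simp only [f]
    linarith
  · intro s c hc z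
    refine ⟨⟨c * s.1, mul_nonneg hc s.2⟩, ?_⟩
    have h1 := hp.smul_le c hc (z + s.1 • x)
    rw [smul_add, smul_smul] at h1
    simp only [f]
    linarith
  · intro s t y z
    have key : ∀ r, f r (y ⊔ z) ≤ max (f r y) (f r z) := by
      intro r
      simp only [f]
      rw [sup_add, max_sub_sub_right]
      exact sub_le_sub_right (hp.sup_le _ _) _
    rcases le_total s.1 t.1 with h | h
    · exact ⟨t, (key t).trans (max_le_max (hanti s t y h) le_rfl)⟩
    · exact ⟨s, (key s).trans (max_le_max le_rfl (hanti t s z h))⟩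
  · intro z
    refine (ciInf_le (hb z) ⟨0, le_rfl⟩).trans ?_
    simp [f]
  · refine (ciInf_le (hb (-x)) ⟨1, zero_le_one⟩).trans ?_
    simp [f, hp.map_zero]

/-- Every `IsMaxSublinear` functional which is bounded by an order unit dominates a linear one. -/
theorem exists_linear_le {e : V} (he : ∀ x : V, ∃ c : ℝ, 0 ≤ c ∧ x ≤ c • e)
    (hp : IsMaxSublinear p) (hpe : p e ≤ 1) :
    ∃ ω : V →ₗ[ℝ] ℝ, (∀ x y, ω (x ⊔ y) = max (ω x) (ω y)) ∧ ∀ x, ω x ≤ p x := by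
  -- The order dual turns Zorn's maximal element into a minimal functional. The order unit bounds
  -- chains below, via `q x ≥ -q (-x)`.
  let S : Set (V → ℝ)ᵒᵈ := {q | IsMaxSublinear (OrderDual.ofDual q) ∧ OrderDual.ofDual q ≤ p}
  have hzorn : ∃ m, OrderDual.toDual p ≤ m ∧ Maximal (· ∈ S) m := by
    refine zorn_le_nonempty₀ S ?_ (OrderDual.toDual p) ⟨hp, le_rfl⟩
    intro c hcS hc y hy
    let c' : Set (V → ℝ) := c
    have hb : ∀ x, BddBelow (Set.range fun q : c' => q.1 x) := by
      intro x
      obtain ⟨d, hd, hxd⟩ := he (-x)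
      refine ⟨-d, ?_⟩
      rintro _ ⟨⟨q, hq⟩, rfl⟩
      obtain ⟨h1, h2⟩ := hcS hq
      have h3 := h1.neg_le x
      have h4 := h1.mono hxd
      have h5 := h1.smul_le d hd e
      have h6 : q e ≤ 1 := (h2 e).trans hpe
      have h7 : d * q e ≤ d * 1 := mul_le_mul_of_nonneg_left h6 hd
      have h8 : q (-x) ≤ d * q e := h4.trans h5
      have h9 : -q (-x) ≤ q x := h3
      change -d ≤ q x
      linarith
    have hinf := iInf_chain (c := c') ⟨y, hy⟩ hc.symm (fun q hq => (hcS hq).1) hb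
    refine ⟨fun x => ⨅ q : c', q.1 x, ⟨hinf, fun x => ?_⟩, ?_⟩
    · exact (ciInf_le (hb x) ⟨y, hy⟩).trans ((hcS hy).2 x)
    · intro z hz x
      exact ciInf_le (hb x) ⟨z, hz⟩
  obtain ⟨m, -, ⟨hm, hmp⟩, hmax⟩ := hzorn
  let q : V → ℝ := m
  have hq : IsMaxSublinear q := hm
  -- Minimality forces `q` to lie below its directional modification, so `q (-x) ≤ -q x`. An odd
  -- sublinear functional is linear.
  have hneg : ∀ x, q (-x) = -q x := by
    intro x
    obtain ⟨r, hr, hrq, hrx⟩ := hq.exists_le_neg x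
    have h1 : q ≤ r := hmax (y := r) ⟨hr, hrq.trans hmp⟩ hrq
    have h2 := hq.neg_le (-x)
    rw [neg_neg] at h2
    have := h1 (-x)
    linarith
  refine ⟨{ toFun := q, map_add' := fun x y => ?_, map_smul' := fun c x => ?_ }, hq.map_sup, hmp⟩
  · refine le_antisymm (hq.add_le x y) ?_
    have h1 := hq.add_le (-x) (-y)
    rw [← neg_add, hneg, hneg, hneg] at h1
    linarith
  · rcases le_total 0 c with h | h
    · exact hq.smul_eq h x
    · have h1 := hq.smul_eq (neg_nonneg.2 h) x
      rw [neg_smul, hneg] at h1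
      simp only [RingHom.id_apply, smul_eq_mul]
      linarith

end IsMaxSublinear

variable [IsOrderedAddMonoid V] [IsOrderedModule ℝ V] {e : V}

/-- The gauge `x ↦ inf {c | x ≤ c • e}` of an order unit. -/
theorem exists_gauge (he0 : 0 ≤ e) (he1 : ¬ e ≤ 0) (he : ∀ x : V, ∃ c : ℝ, 0 ≤ c ∧ x ≤ c • e) :
    ∃ p : V → ℝ, IsMaxSublinear p ∧ ∀ x c, (x ≤ c • e → p x ≤ c) ∧ (p x < c → x ≤ c • e) := by
  have hup : ∀ {x : V} {c d : ℝ}, x ≤ c • e → c ≤ d → x ≤ d • e := fun h1 h2 =>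
    h1.trans (smul_le_smul_of_nonneg_right h2 he0)
  have hb : ∀ x : V, BddBelow (Set.range fun c : {c : ℝ // x ≤ c • e} => c.1) := by
    intro x
    obtain ⟨d, -, hd⟩ := he (-x)
    refine ⟨-d, ?_⟩
    rintro _ ⟨⟨c, hc⟩, rfl⟩
    by_contra! h
    have h1 : (0 : V) ≤ (c + d) • e := by
      rw [add_smul, ← add_neg_cancel x]
      exact add_le_add hc hd
    have h2 : (0 : V) ≤ (-(c + d)) • e := smul_nonneg (by simp only at h; linarith) he0
    rw [neg_smul, Left.nonneg_neg_iff] at h2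
    have h3 : (c + d) • e = 0 := le_antisymm h2 h1
    rcases smul_eq_zero.1 h3 with h4 | h4
    · simp only at h; linarith
    · exact he1 h4.le
  have : ∀ x : V, Nonempty {c : ℝ // x ≤ c • e} := fun x => let ⟨c, _, hc⟩ := he x; ⟨c, hc⟩
  let p : V → ℝ := fun x => ⨅ c : {c : ℝ // x ≤ c • e}, c.1
  have h1 : ∀ {x c}, x ≤ c • e → p x ≤ c := fun {x c} h => ciInf_le (hb x) ⟨c, h⟩
  have h2 : ∀ {x c}, p x < c → x ≤ c • e := by
    intro x c h
    obtain ⟨⟨d, hd⟩, hdc⟩ := exists_lt_of_ciInf_lt h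
    exact hup hd hdc.le
  refine ⟨p, ⟨?_, ?_, ?_, ?_⟩, fun x c => ⟨h1, h2⟩⟩
  · intro x y h
    exact le_ciInf fun c => h1 (h.trans c.2)
  · intro x y
    refine le_ciInf_add_ciInf fun c d => h1 ?_
    rw [add_smul]
    exact add_le_add c.2 d.2
  · intro c hc x
    simp only [p]
    rw [Real.mul_iInf_of_nonneg hc]
    refine le_ciInf fun d => h1 ?_
    rw [mul_smul]
    exact smul_le_smul_of_nonneg_left d.2 hc
  · intro x y
    refine le_of_forall_pos_lt_add fun ε hε => ?_
    have : p (x ⊔ y) ≤ max (p x) (p y) + ε / 2 := by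
      refine h1 (sup_le (h2 ?_) (h2 ?_))
      · have := le_max_left (p x) (p y); linarith
      · have := le_max_right (p x) (p y); linarith
    linarith

/-- **Yosida**: in an Archimedean vector lattice with order unit `e`, the real lattice
homomorphisms normalized at `e` determine the order. -/
theorem exists_latticeHom_pos (he0 : 0 ≤ e) (he : ∀ x : V, ∃ c : ℝ, 0 ≤ c ∧ x ≤ c • e)
    {y : V} {ε : ℝ} (hε : 0 < ε) (hy : ¬ y ≤ ε • e) :
    ∃ ω : V →ₗ[ℝ] ℝ, (∀ x y, ω (x ⊔ y) = max (ω x) (ω y)) ∧ ω e = 1 ∧ 0 < ω y := by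
  have he1 : ¬ e ≤ 0 := by
    intro h
    obtain rfl : e = 0 := le_antisymm h he0
    obtain ⟨c, -, hc⟩ := he y
    simp only [smul_zero] at hc hy
    exact hy hc
  obtain ⟨p, hp, hpc⟩ := exists_gauge he0 he1 he
  -- Modifying the gauge in direction `y` first makes every linear `ω ≤ q` satisfy `ω y ≥ p y ≥ ε`.
  -- The normalization `ω e = 1` comes from `p e ≤ 1` and `p (-e) ≤ -1`.
  obtain ⟨q, hq, hqp, hqy⟩ := hp.exists_le_neg y
  have hpe : p e ≤ 1 := (hpc e 1).1 (by simp)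
  have hpe' : p (-e) ≤ -1 := (hpc (-e) (-1)).1 (by simp)
  obtain ⟨ω, hω, hωq⟩ := hq.exists_linear_le he ((hqp e).trans hpe)
  refine ⟨ω, hω, le_antisymm ((hωq e).trans ((hqp e).trans hpe)) ?_, ?_⟩
  · have := (hωq (-e)).trans ((hqp (-e)).trans hpe')
    rw [map_neg] at this
    linarith
  · have h1 : ε ≤ p y := by
      by_contra! h
      exact hy ((hpc y ε).2 h)
    have := (hωq (-y)).trans hqy
    rw [map_neg] at this
    linarith

end Yosida

/-! ### Parametrization by the Cantor set and representation in `C(Δ)` -/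

/-- A nonempty compact subset of a product of lines on which countably many coordinates separate
the points is a continuous image of the Cantor set. -/
theorem exists_cantorSet_map_range_eq {ι : Type*} {S : Set (ι → ℝ)} (hS : IsCompact S)
    (hne : S.Nonempty) (u : ℕ → ι)
    (hu : ∀ f ∈ S, ∀ g ∈ S, (∀ n, f (u n) = g (u n)) → f = g) :
    ∃ σ : cantorSet → ι → ℝ, Continuous σ ∧ Set.range σ = S := by
  have : CompactSpace S := isCompact_iff_compactSpace.1 hS
  have : Nonempty S := hne.to_subtype
  let r : S → ℕ → ℝ := fun f n => f.1 (u n)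
  have hr : Continuous r :=
    continuous_pi fun n => (continuous_apply (u n)).comp continuous_subtype_val
  have hinj : Function.Injective r := fun f g h =>
    Subtype.ext (hu f.1 f.2 g.1 g.2 fun n => congrFun h n)
  -- The separating coordinates embed the compact set in `ℕ → ℝ`, so it is metrizable and hence an
  -- image of the space of binary sequences.
  have hmetr : TopologicalSpace.MetrizableSpace S :=
    (hr.isClosedEmbedding hinj).isEmbedding.metrizableSpace
  let _ : MetricSpace S := TopologicalSpace.metrizableSpaceMetric S
  obtain ⟨g, hg, hgs⟩ := exists_nat_bool_continuous_surjective_of_compact S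
  refine ⟨fun c => (g (cantorSetHomeomorphNatToBool c)).1,
    continuous_subtype_val.comp (hg.comp cantorSetHomeomorphNatToBool.continuous), ?_⟩
  ext f
  constructor
  · rintro ⟨c, rfl⟩
    exact (g _).2
  · intro hf
    obtain ⟨b, hb⟩ := hgs ⟨f, hf⟩
    exact ⟨cantorSetHomeomorphNatToBool.symm b, by simp [hb]⟩

section Representation

variable {V : Type w} [AddCommGroup V] [Lattice V] [IsOrderedAddMonoid V] [Module ℝ V]
  [IsOrderedModule ℝ V] {e : V}

/-- A countably generated Archimedean vector lattice with order unit embeds into the continuous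
functions on the Cantor set. -/
theorem exists_cantorSet_representation (he0 : 0 ≤ e) (he1 : ¬ e ≤ 0)
    (he : ∀ x : V, ∃ c : ℝ, 0 ≤ c ∧ x ≤ c • e)
    (harch : ∀ y : V, (∀ ε : ℝ, 0 < ε → y ≤ ε • e) → y ≤ 0) (u : ℕ → V)
    (hu : ∀ ω₁ ω₂ : V →ₗ[ℝ] ℝ, (∀ x y, ω₁ (x ⊔ y) = max (ω₁ x) (ω₁ y)) →
      (∀ x y, ω₂ (x ⊔ y) = max (ω₂ x) (ω₂ y)) → ω₁ e = 1 → ω₂ e = 1 →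
      (∀ n, ω₁ (u n) = ω₂ (u n)) → ω₁ = ω₂) :
    ∃ J : V →ₗ[ℝ] C(cantorSet, ℝ), (∀ x y, J (x ⊔ y) = J x ⊔ J y) ∧ J e = 1 ∧
      ∀ x, J x ≤ 0 → x ≤ 0 := by
  -- The Yosida spectrum of `V`, compact by Tychonoff; `J` is evaluation on it, pulled back to the
  -- Cantor set.
  let S : Set (V → ℝ) := {ω | (∀ x y, ω (x + y) = ω x + ω y) ∧ (∀ (c : ℝ) x, ω (c • x) = c * ω x) ∧
    (∀ x y, ω (x ⊔ y) = max (ω x) (ω y)) ∧ ω e = 1}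
  let lin : ∀ ω ∈ S, V →ₗ[ℝ] ℝ := fun ω hω =>
    { toFun := ω, map_add' := hω.1, map_smul' := hω.2.1 }
  have hmem : ∀ ω : V →ₗ[ℝ] ℝ, (∀ x y, ω (x ⊔ y) = max (ω x) (ω y)) → ω e = 1 → ⇑ω ∈ S :=
    fun ω h1 h2 => ⟨map_add ω, map_smul ω, h1, h2⟩
  choose c hc0 hc using he
  have hbound : ∀ ω ∈ S, ∀ x, ω x ≤ c x := by
    intro ω hω x
    have h1 := hω.2.2.1 x (c x • e)
    rw [sup_eq_right.2 (hc x), hω.2.1, hω.2.2.2, mul_one] at h1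
    rw [h1]
    exact le_max_left _ _
  have hclosed : IsClosed S := by
    simp only [S, Set.ofPred_and, Set.ofPred_forall]
    refine IsClosed.inter (isClosed_iInter fun x => isClosed_iInter fun y => ?_) (IsClosed.inter
      (isClosed_iInter fun x => isClosed_iInter fun y => ?_) (IsClosed.inter
      (isClosed_iInter fun x => isClosed_iInter fun y => ?_) ?_)) <;>
    exact isClosed_eq (by fun_prop) (by fun_prop)
  have hcomp : IsCompact S := by
    refine IsCompact.of_isClosed_subset
      (isCompact_univ_pi fun x : V => isCompact_Icc (a := -c (-x)) (b := c x)) hclosed ?_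
    intro ω hω x _
    refine ⟨?_, hbound ω hω x⟩
    have h1 := hbound ω hω (-x)
    have h2 : ω (-x) = -ω x := map_neg (lin ω hω) x
    linarith
  have hne : S.Nonempty := by
    have h0 : ¬ ∀ ε : ℝ, 0 < ε → e ≤ ε • e := fun h => he1 (harch e h)
    push Not at h0
    obtain ⟨ε, hε, h⟩ := h0
    obtain ⟨ω, h1, h2, -⟩ := exists_latticeHom_pos he0 (fun x => ⟨c x, hc0 x, hc x⟩) hε h
    exact ⟨ω, hmem ω h1 h2⟩
  obtain ⟨σ, hσ, hσS⟩ := exists_cantorSet_map_range_eq hcomp hne u fun f hf g hg h => by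
    have := hu (lin f hf) (lin g hg) hf.2.2.1 hg.2.2.1 hf.2.2.2 hg.2.2.2 h
    exact congrArg (fun ω : V →ₗ[ℝ] ℝ => (ω : V → ℝ)) this
  have hσm : ∀ t, σ t ∈ S := fun t => hσS ▸ Set.mem_range_self t
  refine ⟨{ toFun := fun x => ⟨fun t => σ t x, by fun_prop⟩
            map_add' := fun x y => ?_
            map_smul' := fun a x => ?_ }, fun x y => ?_, ?_, fun x hx => ?_⟩
  · ext t; exact (hσm t).1 x y
  · ext t; exact (hσm t).2.1 a x
  · ext t; exact (hσm t).2.2.1 x y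
  · ext t; exact (hσm t).2.2.2
  · by_contra hx0
    have h0 : ¬ ∀ ε : ℝ, 0 < ε → x ≤ ε • e := fun h => hx0 (harch x h)
    push Not at h0
    obtain ⟨ε, hε, h⟩ := h0
    obtain ⟨ω, h1, h2, h3⟩ := exists_latticeHom_pos he0 (fun x => ⟨c x, hc0 x, hc x⟩) hε h
    have h4 : ⇑ω ∈ Set.range σ := hσS ▸ hmem ω h1 h2
    obtain ⟨t, ht⟩ := h4
    have h5 : σ t x ≤ 0 := hx t
    rw [ht] at h5
    exact absurd h3 (not_lt.2 h5)

end Representation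

/-! ### Norming families of positive functionals -/

section Norming

variable {V : Type w} [NormedAddCommGroup V] [Lattice V] [HasSolidNorm V] [IsOrderedAddMonoid V]
  [NormedSpace ℝ V] [IsOrderedModule ℝ V] {e : V} {K : Type v} [TopologicalSpace K] [CompactSpace K]

/-- The norm of a positive element is attained by a positive functional that is dominated by the
norm. -/
theorem exists_positive_functional_norming {J : V →ₗ[ℝ] C(K, ℝ)} (hJe : J e = 1)
    (hJ : ∀ x, J x ≤ 0 → x ≤ 0) {x : V} (hx : 0 ≤ x) :
    ∃ ν : C(K, ℝ) →ₗ[ℝ] ℝ, (∀ f, 0 ≤ f → 0 ≤ ν f) ∧ (∀ y, ν (J y) ≤ ‖y‖) ∧ ν (J x) = ‖x‖ := by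
  -- The least norm in `V` of an element dominating `f` is a sublinear functional. Hahn–Banach below
  -- it yields `ν`, positive because `0` dominates `-f` when `f ≥ 0`.
  let N : C(K, ℝ) → ℝ := fun f => ⨅ y : {y : V // f ≤ J y}, ‖y.1‖
  have hb : ∀ f : C(K, ℝ), BddBelow (Set.range fun y : {y : V // f ≤ J y} => ‖y.1‖) := fun f =>
    ⟨0, by rintro _ ⟨y, rfl⟩; exact norm_nonneg _⟩
  have hne : ∀ f : C(K, ℝ), Nonempty {y : V // f ≤ J y} := fun f => by
    refine ⟨‖f‖ • e, fun t => ?_⟩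
    rw [map_smul, hJe]
    simpa using (le_abs_self (f t)).trans (f.norm_coe_le_norm t)
  have hle : ∀ {f y}, f ≤ J y → N f ≤ ‖y‖ := fun {f y} h => ciInf_le (hb f) ⟨y, h⟩
  have hN0 : ∀ f, 0 ≤ N f := fun f => Real.iInf_nonneg fun y => norm_nonneg _
  have hsmul : ∀ c : ℝ, 0 < c → ∀ f, N (c • f) ≤ c * N f := by
    intro c hc f
    simp only [N]
    rw [Real.mul_iInf_of_nonneg hc.le]
    refine le_ciInf fun y => ?_
    have : c • f ≤ J (c • y.1) := by
      rw [map_smul]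
      intro t
      exact mul_le_mul_of_nonneg_left (y.2 t) hc.le
    refine (hle this).trans ?_
    rw [norm_smul, Real.norm_of_nonneg hc.le]
  have hhom : ∀ c : ℝ, 0 < c → ∀ f, N (c • f) = c * N f := by
    intro c hc f
    refine le_antisymm (hsmul c hc f) ?_
    have := hsmul c⁻¹ (inv_pos.2 hc) (c • f)
    rw [inv_smul_smul₀ hc.ne', inv_mul_eq_div, le_div_iff₀ hc] at this
    linarith
  have hadd : ∀ f g, N (f + g) ≤ N f + N g := by
    intro f g
    refine le_ciInf_add_ciInf fun y z => (hle (y := y.1 + z.1) ?_).trans (norm_add_le _ _)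
    rw [map_add]
    exact add_le_add y.2 z.2
  have hmono : ∀ y z, J y ≤ J z → y ≤ z := fun y z h => by
    rw [← sub_nonpos]
    refine hJ _ ?_
    rw [map_sub]
    exact sub_nonpos.2 h
  -- For `t ≥ 0` any `y` whose image dominates `t • J x` satisfies `0 ≤ t • x ≤ y`, so solidity of
  -- the norm applies.
  have key : ∀ t : ℝ, t * ‖x‖ ≤ N (t • J x) := by
    intro t
    rcases lt_or_ge t 0 with ht | ht
    · exact (mul_nonpos_of_nonpos_of_nonneg ht.le (norm_nonneg x)).trans (hN0 _)
    · refine le_ciInf fun y => ?_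
      have h1 : t • x ≤ y.1 := hmono _ _ (by rw [map_smul]; exact y.2)
      have h2 : ‖t • x‖ ≤ ‖y.1‖ := norm_le_norm_of_abs_le_abs (by
        rw [abs_of_nonneg (smul_nonneg ht hx)]
        exact h1.trans (le_abs_self _))
      rwa [norm_smul, Real.norm_of_nonneg ht] at h2
  obtain ⟨ν, hν⟩ : ∃ ν : C(K, ℝ) →ₗ[ℝ] ℝ, ν (J x) = ‖x‖ ∧ ∀ f, ν f ≤ N f := by
    by_cases hx0 : x = 0
    · exact ⟨0, by simp [hx0], fun f => by simpa using hN0 f⟩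
    · have hJx : J x ≠ 0 := fun h => by
        have h1 := hJ x h.le
        exact hx0 (le_antisymm h1 hx)
      obtain ⟨ν, h1, h2⟩ := exists_extension_of_le_sublinear
        (LinearPMap.mkSpanSingleton (K := ℝ) (J x) ‖x‖ hJx) N hhom hadd (by
          rintro ⟨f, hf⟩
          obtain ⟨t, rfl⟩ := Submodule.mem_span_singleton.1 hf
          exact (LinearPMap.mkSpanSingleton'_apply _ _ _ t hf).trans_le (key t))
      refine ⟨ν, ?_, h2⟩
      have := h1 ⟨J x, Submodule.mem_span_singleton_self _⟩
      exact this.trans (LinearPMap.mkSpanSingleton_apply ℝ ℝ hJx ‖x‖)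
  refine ⟨ν, fun f hf => ?_, fun y => (hν.2 _).trans (hle le_rfl), hν.1⟩
  have h1 : N (-f) ≤ ‖(0 : V)‖ := hle (by rw [map_zero]; exact neg_nonpos.2 hf)
  have h2 := (hν.2 (-f)).trans h1
  rw [map_neg, norm_zero] at h2
  linarith

/-- The positive functionals that are dominated by the norm of `V` are parametrized by the Cantor
set. -/
theorem exists_cantorSet_norming_family [SecondCountableTopology K] [T2Space K] {J : V →ₗ[ℝ] C(K, ℝ)}
    (hJsup : ∀ x y, J (x ⊔ y) = J x ⊔ J y)
    (hJe : J e = 1) (he : ‖e‖ ≤ 1) (hJ : ∀ x, J x ≤ 0 → x ≤ 0) :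
    ∃ ν : cantorSet → C(K, ℝ) →ₗ[ℝ] ℝ, (∀ z f, 0 ≤ f → 0 ≤ ν z f) ∧ (∀ z, ν z 1 ≤ 1) ∧
      (∀ f, Continuous fun z => ν z f) ∧ (∀ z y, ν z (J y) ≤ ‖y‖) ∧
      ∀ x, ∃ z, ν z |J x| = ‖x‖ := by
  let S : Set (C(K, ℝ) → ℝ) := {φ | (∀ f g, φ (f + g) = φ f + φ g) ∧
    (∀ (c : ℝ) f, φ (c • f) = c * φ f) ∧ (∀ f, 0 ≤ f → 0 ≤ φ f) ∧ ∀ y, φ (J y) ≤ ‖y‖}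
  let lin : ∀ φ ∈ S, C(K, ℝ) →ₗ[ℝ] ℝ := fun φ hφ =>
    { toFun := φ, map_add' := hφ.1, map_smul' := hφ.2.1 }
  have hmem : ∀ φ : C(K, ℝ) →ₗ[ℝ] ℝ, (∀ f, 0 ≤ f → 0 ≤ φ f) → (∀ y, φ (J y) ≤ ‖y‖) → ⇑φ ∈ S :=
    fun φ h1 h2 => ⟨map_add φ, map_smul φ, h1, h2⟩
  have hone : ∀ φ ∈ S, φ 1 ≤ 1 := fun φ hφ => by
    have := hφ.2.2.2 e
    rw [hJe] at this
    exact this.trans he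
  have hbound : ∀ φ ∈ S, ∀ f, φ f ≤ ‖f‖ := by
    intro φ hφ f
    have h1 : 0 ≤ ‖f‖ • (1 : C(K, ℝ)) - f := by
      intro t
      have := (le_abs_self (f t)).trans (f.norm_coe_le_norm t)
      simpa using this
    have h2 := hφ.2.2.1 _ h1
    have h3 : φ (‖f‖ • (1 : C(K, ℝ)) - f) = ‖f‖ * φ 1 - φ f := by
      rw [← hφ.2.1]
      exact map_sub (lin φ hφ) _ _
    have h4 : ‖f‖ * φ 1 ≤ ‖f‖ * 1 := mul_le_mul_of_nonneg_left (hone φ hφ) (norm_nonneg f)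
    linarith
  have habs : ∀ φ ∈ S, ∀ f, |φ f| ≤ ‖f‖ := by
    intro φ hφ f
    refine abs_le.2 ⟨?_, hbound φ hφ f⟩
    have h1 := hbound φ hφ (-f)
    have h2 : φ (-f) = -φ f := map_neg (lin φ hφ) f
    rw [norm_neg] at h1
    linarith
  have hclosed : IsClosed S := by
    simp only [S, Set.ofPred_and, Set.ofPred_forall]
    refine IsClosed.inter (isClosed_iInter fun x => isClosed_iInter fun y => ?_) (IsClosed.inter
      (isClosed_iInter fun x => isClosed_iInter fun y => ?_) (IsClosed.inter
      (isClosed_iInter fun x => isClosed_iInter fun y => ?_) (isClosed_iInter fun x => ?_)))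
    · exact isClosed_eq (by fun_prop) (by fun_prop)
    · exact isClosed_eq (by fun_prop) (by fun_prop)
    · exact isClosed_le (by fun_prop) (by fun_prop)
    · exact isClosed_le (by fun_prop) (by fun_prop)
  have hcomp : IsCompact S := by
    refine IsCompact.of_isClosed_subset
      (isCompact_univ_pi fun f : C(K, ℝ) => isCompact_Icc (a := -‖f‖) (b := ‖f‖)) hclosed ?_
    intro φ hφ f _
    exact abs_le.1 (habs φ hφ f)
  have hcont : ∀ φ ∈ S, Continuous φ := fun φ hφ =>
    AddMonoidHomClass.continuous_of_bound (lin φ hφ) 1 fun f => by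
      rw [one_mul]; exact habs φ hφ f
  -- `C(K, ℝ)` is separable, and elements of `S` are continuous, so their values on a dense sequence
  -- separate them.
  obtain ⟨σ, hσ, hσS⟩ := exists_cantorSet_map_range_eq hcomp
    ⟨_, hmem 0 (fun _ _ => le_rfl) fun y => norm_nonneg y⟩
    (TopologicalSpace.denseSeq C(K, ℝ)) fun f hf g hg h =>
      (TopologicalSpace.denseRange_denseSeq _).equalizer (hcont f hf) (hcont g hg) (funext h)
  have hσm : ∀ t, σ t ∈ S := fun t => hσS ▸ Set.mem_range_self t
  refine ⟨fun z => lin (σ z) (hσm z), fun z => (hσm z).2.2.1, fun z => hone _ (hσm z),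
    fun f => (continuous_apply f).comp hσ, fun z => (hσm z).2.2.2, fun x => ?_⟩
  have hJabs : |J x| = J |x| := by rw [abs, abs, hJsup, map_neg]
  obtain ⟨ν, h1, h2, h3⟩ := exists_positive_functional_norming hJe hJ (abs_nonneg x)
  have h4 : ⇑ν ∈ Set.range σ := hσS ▸ hmem ν h1 h2
  obtain ⟨z, hz⟩ := h4
  refine ⟨z, ?_⟩
  rw [hJabs, ← norm_abs_eq_norm x, ← h3, ← hz]
  rfl

end Norming

/-! ### Representation of positive functionals by quantile functions -/

section Quantile

open ProbabilityTheory Set Filter Topology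

/-- Every probability measure on the line is the image of Lebesgue measure on `[0, 1]` under a
quantile function. -/
theorem exists_quantile (μ : Measure ℝ) [IsProbabilityMeasure μ] :
    ∃ q : ℝ → ℝ, MeasurePreserving q (volume.restrict (Icc (0 : ℝ) 1)) μ ∧
      ∀ s ∈ Ioo (0 : ℝ) 1, ∀ x, q s ≤ x ↔ s ≤ cdf μ x := by
  classical
  -- The generalized inverse of the distribution function; `0` is a default outside `(0, 1)`, where
  -- the infimum may be meaningless.
  let q : ℝ → ℝ := fun s => if s ∈ Ioo (0 : ℝ) 1 then sInf {x | s ≤ cdf μ x} else 0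
  have hq : ∀ s ∈ Ioo (0 : ℝ) 1, ∀ x, q s ≤ x ↔ s ≤ cdf μ x := by
    intro s hs x
    have hne : {x | s ≤ cdf μ x}.Nonempty :=
      (((tendsto_cdf_atTop μ).eventually_const_lt hs.2).exists).imp fun _ h => le_of_lt h
    have hbdd : BddBelow {x | s ≤ cdf μ x} := by
      obtain ⟨b, hb⟩ := ((tendsto_cdf_atBot μ).eventually_lt_const hs.1).exists
      refine ⟨b, fun y hy => ?_⟩
      by_contra! h
      exact absurd ((show s ≤ cdf μ y from hy).trans (monotone_cdf μ h.le)) (not_le.2 hb)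
    simp only [q, if_pos hs]
    constructor
    · intro h
      -- Right continuity shows that the infimum itself satisfies the defining inequality.
      have hright : Tendsto (cdf μ) (𝓝[>] x) (𝓝 (cdf μ x)) :=
        ((cdf μ).right_continuous x).mono_left (nhdsWithin_mono x Ioi_subset_Ici_self)
      refine ge_of_tendsto hright ?_
      filter_upwards [self_mem_nhdsWithin] with y hy
      obtain ⟨z, hz, hzy⟩ := exists_lt_of_csInf_lt hne (h.trans_lt hy)
      exact (show s ≤ cdf μ z from hz).trans (monotone_cdf μ hzy.le)
    · intro h
      exact csInf_le hbdd h
  have hset : ∀ x, q ⁻¹' Iic x ∩ Ioo 0 1 = Iic (cdf μ x) ∩ Ioo 0 1 := by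
    intro x
    ext s
    constructor
    · rintro ⟨h1, h2⟩
      exact ⟨(hq s h2 x).1 h1, h2⟩
    · rintro ⟨h1, h2⟩
      exact ⟨(hq s h2 x).2 h1, h2⟩
  have hmeas : Measurable q := by
    refine measurable_of_Iic fun x => ?_
    have h1 : q ⁻¹' Iic x = (Iic (cdf μ x) ∩ Ioo 0 1) ∪ ((Ioo 0 1)ᶜ ∩ {_s | (0 : ℝ) ≤ x}) := by
      rw [← hset]
      ext s
      by_cases hs : s ∈ Ioo (0 : ℝ) 1
      · simp [hs]
      · have h2 : q s = 0 := if_neg hs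
        simp only [mem_preimage, mem_Iic, mem_union, mem_inter_iff, hs, and_false, mem_compl_iff,
          not_false_eq_true, true_and, false_or, h2]
        rfl
    rw [h1]
    exact (measurableSet_Iic.inter measurableSet_Ioo).union
      (measurableSet_Ioo.compl.inter (MeasurableSet.const _))
  refine ⟨q, ⟨hmeas, ?_⟩, hq⟩
  refine Measure.ext_of_Iic _ _ fun x => ?_
  rw [Measure.map_apply hmeas measurableSet_Iic, Measure.restrict_congr_set Ioo_ae_eq_Icc.symm,
    Measure.restrict_apply (hmeas measurableSet_Iic), hset, ← ofReal_cdf μ x]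
  refine le_antisymm ?_ ?_
  · refine (measure_mono (t := Icc 0 (cdf μ x)) fun s hs => ⟨hs.2.1.le, hs.1⟩).trans ?_
    simp
  · have : Ioo 0 (cdf μ x) ⊆ Iic (cdf μ x) ∩ Ioo 0 1 := fun s hs =>
      ⟨hs.2.le, hs.1, hs.2.trans_le (cdf_le_one μ x)⟩
    refine le_trans ?_ (measure_mono this)
    simp

end Quantile

/-- A positive linear functional on `C(K, ℝ)` is integration against a finite measure. -/
theorem exists_measure_integral_eq {K : Type*} [TopologicalSpace K] [CompactSpace K] [T2Space K]
    [MeasurableSpace K] [BorelSpace K] (ν : C(K, ℝ) →ₗ[ℝ] ℝ) (hν : ∀ f, 0 ≤ f → 0 ≤ ν f) :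
    ∃ μ : Measure K, IsFiniteMeasure μ ∧ ∀ f : C(K, ℝ), ∫ x, f x ∂μ = ν f := by
  let Λ : CompactlySupportedContinuousMap K ℝ →ₚ[ℝ] ℝ := PositiveLinearMap.mk₀
    { toFun := fun f => ν f.toContinuousMap
      map_add' := fun f g => ν.map_add f.toContinuousMap g.toContinuousMap
      map_smul' := fun c f => ν.map_smul c f.toContinuousMap } fun f hf => hν f.toContinuousMap hf
  refine ⟨RealRMK.rieszMeasure Λ, inferInstance, fun f => ?_⟩
  exact RealRMK.integral_rieszMeasure Λ ⟨f, HasCompactSupport.of_compactSpace f⟩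

section ZeroExtend

/-- The extension by zero of a function on the Cantor set to the line. -/
noncomputable def zeroExtend (f : C(cantorSet, ℝ)) : ℝ → ℝ :=
  Function.extend ((↑) : cantorSet → ℝ) f 0

theorem zeroExtend_coe (f : C(cantorSet, ℝ)) (x : cantorSet) : zeroExtend f x = f x :=
  Subtype.val_injective.extend_apply _ _ _

theorem zeroExtend_of_notMem (f : C(cantorSet, ℝ)) {x : ℝ} (hx : x ∉ cantorSet) :
    zeroExtend f x = 0 :=
  Function.extend_apply' _ _ _ (by rintro ⟨y, rfl⟩; exact hx y.2)

theorem measurable_zeroExtend (f : C(cantorSet, ℝ)) : Measurable (zeroExtend f) :=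
  (MeasurableEmbedding.subtype_coe isClosed_cantorSet.measurableSet).measurable_extend
    f.continuous.measurable measurable_zero

theorem abs_zeroExtend_le (f : C(cantorSet, ℝ)) (x : ℝ) : |zeroExtend f x| ≤ ‖f‖ := by
  by_cases hx : x ∈ cantorSet
  · exact (congrArg abs (zeroExtend_coe f ⟨x, hx⟩)).trans_le (f.norm_coe_le_norm _)
  · rw [zeroExtend_of_notMem f hx, abs_zero]
    exact norm_nonneg f

theorem zeroExtend_add (f g : C(cantorSet, ℝ)) (x : ℝ) :
    zeroExtend (f + g) x = zeroExtend f x + zeroExtend g x := by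
  by_cases hx : x ∈ cantorSet
  · lift x to cantorSet using hx
    simp [zeroExtend_coe]
  · simp [zeroExtend_of_notMem _ hx]

theorem zeroExtend_smul (c : ℝ) (f : C(cantorSet, ℝ)) (x : ℝ) :
    zeroExtend (c • f) x = c * zeroExtend f x := by
  by_cases hx : x ∈ cantorSet
  · lift x to cantorSet using hx
    simp [zeroExtend_coe]
  · simp [zeroExtend_of_notMem _ hx]

theorem zeroExtend_sup (f g : C(cantorSet, ℝ)) (x : ℝ) :
    zeroExtend (f ⊔ g) x = zeroExtend f x ⊔ zeroExtend g x := by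
  by_cases hx : x ∈ cantorSet
  · lift x to cantorSet using hx
    simp [zeroExtend_coe]
  · simp [zeroExtend_of_notMem _ hx]

theorem zeroExtend_abs (f : C(cantorSet, ℝ)) (x : ℝ) : zeroExtend |f| x = |zeroExtend f x| := by
  by_cases hx : x ∈ cantorSet
  · lift x to cantorSet using hx
    simp [zeroExtend_coe]
  · simp [zeroExtend_of_notMem _ hx]

end ZeroExtend

theorem two_notMem_cantorSet : (2 : ℝ) ∉ cantorSet := fun h => by
  have := (cantorSet_subset_unitInterval h).2
  norm_num at this

open ProbabilityTheory Set in
/-- A positive functional of mass at most one on `C(cantorSet, ℝ)` is represented by a quantile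
function on `[0, 1]`; the missing mass is sent to the point `2`. -/
theorem exists_quantile_representation (ν : C(cantorSet, ℝ) →ₗ[ℝ] ℝ) (hν : ∀ f, 0 ≤ f → 0 ≤ ν f)
    (h1 : ν 1 ≤ 1) :
    ∃ q : ℝ → ℝ, Measurable q ∧
      (∀ᵐ s ∂volume.restrict (Icc (0 : ℝ) 1), q s ∈ cantorSet ∨ q s = 2) ∧
      (∀ f, ∫ s in Icc (0 : ℝ) 1, zeroExtend f (q s) = ν f) ∧
      ∀ (f : C(cantorSet, ℝ)) (a : ℝ), a < 2 → (∀ x : cantorSet, f x = if x ≤ a then 1 else 0) →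
        ∀ᵐ s ∂volume.restrict (Icc (0 : ℝ) 1), q s ≤ a ↔ s ≤ ν f := by
  obtain ⟨μ, hμ, hμν⟩ := exists_measure_integral_eq ν hν
  have hemb : MeasurableEmbedding ((↑) : cantorSet → ℝ) :=
    MeasurableEmbedding.subtype_coe isClosed_cantorSet.measurableSet
  -- The point `2` lies outside the Cantor set and to its right: extensions by zero vanish there,
  -- and the distribution function at `a < 2` does not see the added mass.
  let P : Measure ℝ := μ.map (↑) + ENNReal.ofReal (1 - ν 1) • Measure.dirac 2
  have huniv : μ univ = ENNReal.ofReal (ν 1) := by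
    have := hμν 1
    simp only [ContinuousMap.one_apply, integral_const, smul_eq_mul, mul_one] at this
    rw [← this, ofReal_measureReal]
  have hprob : IsProbabilityMeasure P := by
    constructor
    simp only [P, Measure.add_apply, Measure.smul_apply, measure_univ, smul_eq_mul, mul_one]
    rw [hemb.map_apply, preimage_univ, huniv, ← ENNReal.ofReal_add (hν 1 zero_le_one)
      (sub_nonneg.2 h1)]
    simp
  obtain ⟨q, hq, hqc⟩ := exists_quantile P
  have hint : ∀ f : C(cantorSet, ℝ), ∀ ρ : Measure ℝ, IsFiniteMeasure ρ →
      Integrable (zeroExtend f) ρ := fun f ρ hρ =>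
    Integrable.of_bound (measurable_zeroExtend f).aestronglyMeasurable ‖f‖
      (Filter.Eventually.of_forall (abs_zeroExtend_le f))
  refine ⟨q, hq.measurable, ?_, fun f => ?_, fun f a ha hf => ?_⟩
  · have hS : MeasurableSet {x : ℝ | x ∈ cantorSet ∨ x = 2} :=
      isClosed_cantorSet.measurableSet.union (measurableSet_singleton 2)
    have hP : ∀ᵐ x ∂P, x ∈ cantorSet ∨ x = 2 := by
      rw [ae_add_measure_iff]
      constructor
      · rw [hemb.ae_map_iff]
        exact Filter.Eventually.of_forall fun x => Or.inl x.2
      · refine Measure.ae_smul_measure ?_ _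
        rw [ae_dirac_iff hS]
        exact Or.inr rfl
    exact hq.quasiMeasurePreserving.ae hP
  · have h2 := integral_map hq.measurable.aemeasurable
      (μ := volume.restrict (Icc (0 : ℝ) 1)) (measurable_zeroExtend f).aestronglyMeasurable
    rw [hq.map_eq] at h2
    have hfin : IsFiniteMeasure (ENNReal.ofReal (1 - ν 1) • Measure.dirac (2 : ℝ)) :=
      Measure.smul_finite _ ENNReal.ofReal_ne_top
    rw [← h2, integral_add_measure (hint f _ inferInstance) (hint f _ inferInstance),
      hemb.integral_map, integral_smul_measure, integral_dirac,
      zeroExtend_of_notMem f two_notMem_cantorSet, smul_zero, add_zero, ← hμν f]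
    simp only [zeroExtend_coe]
  · have hcdf : cdf P a = ν f := by
      rw [cdf_eq_real, ← hμν f]
      have h3 : (fun x : cantorSet => f x) = ((↑) ⁻¹' Iic a : Set cantorSet).indicator 1 := by
        ext x
        rw [hf x]
        simp [indicator]
      rw [h3, integral_indicator_one (measurable_subtype_coe measurableSet_Iic)]
      simp only [Measure.real, P, Measure.add_apply, Measure.smul_apply]
      rw [hemb.map_apply, Measure.dirac_apply' _ measurableSet_Iic]
      simp [indicator, not_le.2 ha]
    have hIoo : ∀ᵐ s ∂volume.restrict (Icc (0 : ℝ) 1), s ∈ Ioo (0 : ℝ) 1 := by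
      rw [Measure.restrict_congr_set Ioo_ae_eq_Icc.symm]
      exact ae_restrict_mem measurableSet_Ioo
    filter_upwards [hIoo] with s hs
    rw [hqc s hs, hcdf]

/-! ### Density of the span of initial segments -/

/-- Between two points of the Cantor set there is a point outside the Cantor set. -/
theorem exists_between_notMem_cantorSet {x y : cantorSet} (h : x < y) :
    ∃ a : ℝ, (x : ℝ) < a ∧ a < y ∧ a ∉ cantorSet := by
  by_contra! hcon
  have hsub : Set.Icc (x : ℝ) y ⊆ cantorSet := by
    intro a ha
    rcases ha.1.eq_or_lt with h1 | h1
    · exact h1 ▸ x.2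
    · rcases ha.2.eq_or_lt with h2 | h2
      · exact h2 ▸ y.2
      · exact hcon a h1 h2
  have htd : TotallyDisconnectedSpace cantorSet :=
    cantorSetHomeomorphNatToBool.symm.totallyDisconnectedSpace
  have hpre : IsPreconnected (((↑) : cantorSet → ℝ) ⁻¹' Set.Icc (x : ℝ) y) := by
    rw [← Topology.IsInducing.subtypeVal.isPreconnected_image, Set.image_preimage_eq_of_subset]
    · exact isPreconnected_Icc
    · simpa using hsub
  have := hpre.subsingleton (x := x) (y := y) ⟨le_rfl, h.le⟩ ⟨h.le, le_rfl⟩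
  exact h.ne this

/-- The continuous functions on the Cantor set which are indicators of initial segments span a
dense subspace. -/
theorem dense_span_initialSegments {D : Set C(cantorSet, ℝ)}
    (hD : ∀ f : C(cantorSet, ℝ), (∃ a < (2 : ℝ), ∀ x : cantorSet, f x = if x ≤ a then 1 else 0) →
      f ∈ D) : Dense (Submodule.span ℝ D : Set C(cantorSet, ℝ)) := by
  -- Products of initial segments are initial segments, so their span is already an algebra and
  -- Stone–Weierstrass applies.
  let M : Submonoid C(cantorSet, ℝ) :=
    { carrier := {f | ∃ a < (2 : ℝ), ∀ x : cantorSet, f x = if x ≤ a then 1 else 0}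
      mul_mem' := by
        rintro f g ⟨a, ha, hf⟩ ⟨b, hb, hg⟩
        refine ⟨min a b, (min_le_left _ _).trans_lt ha, fun x => ?_⟩
        rw [ContinuousMap.mul_apply, hf, hg]
        by_cases h1 : (x : ℝ) ≤ a <;> by_cases h2 : (x : ℝ) ≤ b <;> simp [h1, h2]
      one_mem' := ⟨1, by norm_num, fun x => by
        simp [(cantorSet_subset_unitInterval x.2).2]⟩ }
  let A : Subalgebra ℝ C(cantorSet, ℝ) := Algebra.adjoin ℝ M
  have hA : (A : Set C(cantorSet, ℝ)) = Submodule.span ℝ (M : Set C(cantorSet, ℝ)) := by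
    rw [← Subalgebra.coe_toSubmodule, Algebra.adjoin_eq_span, Submonoid.closure_eq]
  have hsep : A.SeparatesPoints := by
    have key : ∀ x y : cantorSet, x < y →
        ∃ f ∈ (fun f : C(cantorSet, ℝ) => (f : cantorSet → ℝ)) '' (A : Set C(cantorSet, ℝ)),
          f x ≠ f y := by
      intro x y h
      obtain ⟨a, hxa, hay, ha⟩ := exists_between_notMem_cantorSet h
      have hclopen : IsClopen {t : cantorSet | (t : ℝ) ≤ a} := by
        refine ⟨isClosed_le (by fun_prop) (by fun_prop), ?_⟩
        have : {t : cantorSet | (t : ℝ) ≤ a} = {t : cantorSet | (t : ℝ) < a} := by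
          ext t
          exact ⟨fun h => lt_of_le_of_ne (show (t : ℝ) ≤ a from h) fun h' => ha (h' ▸ t.2),
            fun h => le_of_lt (show (t : ℝ) < a from h)⟩
        rw [this]
        exact isOpen_lt (by fun_prop) (by fun_prop)
      let f : C(cantorSet, ℝ) := ⟨fun t => if (t : ℝ) ≤ a then 1 else 0,
        continuous_const.if (by simp [hclopen.frontier_eq]) continuous_const⟩
      refine ⟨f, ⟨f, Algebra.subset_adjoin ⟨a, ?_, fun _ => rfl⟩, rfl⟩, ?_⟩
      · have := (cantorSet_subset_unitInterval y.2).2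
        linarith
      · simp [f, hxa.le, not_le.2 hay]
    intro x y hxy
    rcases lt_or_gt_of_ne hxy with h | h
    · exact key x y h
    · obtain ⟨f, hf, hne⟩ := key y x h
      exact ⟨f, hf, hne.symm⟩
  have htop := ContinuousMap.subalgebra_topologicalClosure_eq_top_of_separatesPoints A hsep
  have hdense : Dense (A : Set C(cantorSet, ℝ)) := by
    rw [dense_iff_closure_eq, ← Subalgebra.topologicalClosure_coe, htop]
    rfl
  refine hdense.mono ?_
  rw [hA]
  exact Submodule.span_mono hD

/-! ### From weak* continuous families to `L₁`-valued continuous functions -/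

section Skorokhod

variable {Z : Type v} [TopologicalSpace Z]

/-- A continuous family of positive functionals on `C(cantorSet, ℝ)` of mass at most one is induced
by a lattice homomorphism into `C(Z, L₁[0,1])`. -/
theorem exists_latticeHom_L1_of_family (ν : Z → C(cantorSet, ℝ) →ₗ[ℝ] ℝ)
    (hν : ∀ z f, 0 ≤ f → 0 ≤ ν z f) (h1 : ∀ z, ν z 1 ≤ 1) (hc : ∀ f, Continuous fun z => ν z f) :
    ∃ T : C(cantorSet, ℝ) →ₗ[ℝ] C(Z, L1Interval), (∀ f g, T (f ⊔ g) = T f ⊔ T g) ∧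
      ∀ f z, ‖T f z‖ = ν z |f| := by
  choose q hqm hqmem hqint hqstep using fun z => exists_quantile_representation (ν z) (hν z) (h1 z)
  have hint : ∀ f z, Integrable (fun s => zeroExtend f (q z s))
      (volume.restrict (Set.Icc (0 : ℝ) 1)) := fun f z =>
    Integrable.of_bound ((measurable_zeroExtend f).comp (hqm z)).aestronglyMeasurable ‖f‖
      (Filter.Eventually.of_forall fun s => abs_zeroExtend_le f _)
  let S : C(cantorSet, ℝ) → Z → L1Interval := fun f z => (hint f z).toL1
  have hS : ∀ f z, S f z =ᵐ[volume.restrict (Set.Icc (0 : ℝ) 1)]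
      fun s => zeroExtend f (q z s) := fun f z => Integrable.coeFn_toL1 (hint f z)
  have hadd : ∀ f g z, S (f + g) z = S f z + S g z := by
    intro f g z
    rw [Lp.ext_iff]
    filter_upwards [hS (f + g) z, hS f z, hS g z, Lp.coeFn_add (S f z) (S g z)] with s a1 a2 a3 a4
    rw [a1, a4, Pi.add_apply, a2, a3, zeroExtend_add]
  have hsmul : ∀ (c : ℝ) f z, S (c • f) z = c • S f z := by
    intro c f z
    rw [Lp.ext_iff]
    filter_upwards [hS (c • f) z, hS f z, Lp.coeFn_smul c (S f z)] with s a1 a2 a3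
    rw [a1, a3, Pi.smul_apply, a2, zeroExtend_smul, smul_eq_mul]
  have hsup : ∀ f g z, S (f ⊔ g) z = S f z ⊔ S g z := by
    intro f g z
    rw [Lp.ext_iff]
    filter_upwards [hS (f ⊔ g) z, hS f z, hS g z, Lp.coeFn_sup (S f z) (S g z)] with s a1 a2 a3 a4
    rw [a1, a4, Pi.sup_apply, a2, a3, zeroExtend_sup]
  have hnorm : ∀ f z, ‖S f z‖ = ν z |f| := by
    intro f z
    rw [L1.norm_eq_integral_norm, ← hqint]
    refine integral_congr_ae ?_
    filter_upwards [hS f z] with s hs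
    rw [hs, zeroExtend_abs, Real.norm_eq_abs]
  have hsub : ∀ f g z, S f z - S g z = S (f - g) z := fun f g z => by
    rw [sub_eq_iff_eq_add, ← hadd, sub_add_cancel]
  have hbound : ∀ f z, ‖S f z‖ ≤ ‖f‖ := by
    intro f z
    rw [hnorm]
    have h2 : 0 ≤ ‖f‖ • (1 : C(cantorSet, ℝ)) - |f| := by
      intro t
      have := f.norm_coe_le_norm t
      simpa using this
    have h3 := hν z _ h2
    rw [map_sub, map_smul, smul_eq_mul] at h3
    have h4 : ‖f‖ * ν z 1 ≤ ‖f‖ * 1 := mul_le_mul_of_nonneg_left (h1 z) (norm_nonneg f)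
    linarith
  -- Continuity of `S f` is a linear condition on `f`. It is checked on initial segments and passes
  -- to uniform limits by `hbound`.
  let A : Submodule ℝ C(cantorSet, ℝ) :=
    { carrier := {f | Continuous (S f)}
      add_mem' := fun {f g} hf hg => by
        have : S (f + g) = fun z => S f z + S g z := funext (hadd f g)
        simp only [Set.mem_ofPred_eq, this] at *
        exact hf.add hg
      zero_mem' := by
        have : S 0 = fun _ => 0 := funext fun z => by simpa using hsmul 0 0 z
        simp only [Set.mem_ofPred_eq, this]
        exact continuous_const
      smul_mem' := fun c f hf => by
        have : S (c • f) = fun z => c • S f z := funext (hsmul c f)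
        simp only [Set.mem_ofPred_eq, this] at *
        exact hf.const_smul c }
  have hstep : ∀ f : C(cantorSet, ℝ),
      (∃ a < (2 : ℝ), ∀ x : cantorSet, f x = if x ≤ a then 1 else 0) → f ∈ A := by
    rintro f ⟨a, ha, hf⟩
    have hone : Integrable (fun _ : ℝ => (1 : ℝ)) (volume.restrict (Set.Icc (0 : ℝ) 1)) :=
      integrable_const 1
    have hcont := (continuous_indicator_Iic_toLp hone).comp (hc f)
    refine hcont.congr fun z => ?_
    rw [Function.comp_apply, Lp.ext_iff]
    filter_upwards [hS f z, hqstep z f a ha hf, hqmem z,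
      Integrable.coeFn_toL1 (hone.indicator (measurableSet_Iic (a := ν z f)))] with s a1 a2 a3 a4
    rw [a1, a4]
    rcases a3 with h | h
    · have h5 := zeroExtend_coe f ⟨q z s, h⟩
      simp only at h5
      rw [h5, hf]
      simp only [Set.indicator, Set.mem_Iic, a2]
    · have h5 : ¬ s ≤ ν z f := by
        rw [← a2, h, not_le]
        exact ha
      rw [h, zeroExtend_of_notMem _ two_notMem_cantorSet]
      simp [Set.indicator, h5]
  have hcont : ∀ f, Continuous (S f) := by
    intro f
    have hdense : Dense (A : Set C(cantorSet, ℝ)) := by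
      have := dense_span_initialSegments (D := A) hstep
      rwa [Submodule.span_eq] at this
    refine continuous_of_uniform_approx_of_continuous fun U hU => ?_
    obtain ⟨ε, hε, hεU⟩ := Metric.mem_uniformity_dist.1 hU
    obtain ⟨g, hg, hfg⟩ := Metric.dense_iff.1 hdense f ε hε
    refine ⟨S g, hfg, fun z => hεU ?_⟩
    rw [dist_eq_norm, hsub]
    refine (hbound _ _).trans_lt ?_
    rwa [Metric.mem_ball, dist_comm, dist_eq_norm] at hg
  exact ⟨{ toFun := fun f => ⟨S f, hcont f⟩
           map_add' := fun f g => ContinuousMap.ext (hadd f g)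
           map_smul' := fun c f => ContinuousMap.ext (hsmul c f) },
    fun f g => ContinuousMap.ext (hsup f g), hnorm⟩

end Skorokhod

/-! ### Generated vector sublattices -/

section Sublattice

variable {X : Type w} [NormedAddCommGroup X] [NormedSpace ℝ X] [Lattice X]

/-- The vector sublattice generated by a set. -/
def vectorSublatticeClosure (s : Set X) : Submodule ℝ X :=
  sInf {S | s ⊆ S ∧ ∀ x ∈ S, ∀ y ∈ S, x ⊔ y ∈ S}

variable {s : Set X}

theorem subset_vectorSublatticeClosure : s ⊆ vectorSublatticeClosure s := fun x hx => by
  simp only [vectorSublatticeClosure, SetLike.mem_coe, Submodule.mem_sInf]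
  exact fun S hS => hS.1 hx

theorem vectorSublatticeClosure_le {S : Submodule ℝ X} (h1 : s ⊆ S)
    (h2 : ∀ x ∈ S, ∀ y ∈ S, x ⊔ y ∈ S) : vectorSublatticeClosure s ≤ S :=
  sInf_le ⟨h1, h2⟩

theorem sup_mem_vectorSublatticeClosure {x y : X} (hx : x ∈ vectorSublatticeClosure s)
    (hy : y ∈ vectorSublatticeClosure s) : x ⊔ y ∈ vectorSublatticeClosure s := by
  simp only [vectorSublatticeClosure, Submodule.mem_sInf] at *
  exact fun S hS => hS.2 _ (hx S hS) _ (hy S hS)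

variable [IsBanachLattice X]

theorem inf_mem_vectorSublatticeClosure {x y : X} (hx : x ∈ vectorSublatticeClosure s)
    (hy : y ∈ vectorSublatticeClosure s) : x ⊓ y ∈ vectorSublatticeClosure s := by
  rw [← neg_neg (x ⊓ y), neg_inf]
  exact neg_mem (sup_mem_vectorSublatticeClosure (neg_mem hx) (neg_mem hy))

instance vectorSublatticeClosure.instLattice : Lattice (vectorSublatticeClosure s) :=
  Subtype.lattice (fun _ _ hx hy => sup_mem_vectorSublatticeClosure hx hy)
    fun _ _ hx hy => inf_mem_vectorSublatticeClosure hx hy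

instance vectorSublatticeClosure.instHasSolidNorm : HasSolidNorm (vectorSublatticeClosure s) where
  solid := fun _ _ h => HasSolidNorm.solid (α := X) h

instance vectorSublatticeClosure.instIsOrderedModule :
    IsOrderedModule ℝ (vectorSublatticeClosure s) where
  smul_le_smul_of_nonneg_left := fun _ ha f g h =>
    smul_le_smul_of_nonneg_left (α := ℝ) (β := X) (show (f : X) ≤ g from h) ha
  smul_le_smul_of_nonneg_right := fun f hf _ _ h =>
    smul_le_smul_of_nonneg_right (α := ℝ) (β := X) h (show 0 ≤ (f : X) from hf)

/-- A vector sublattice of the vector sublattice generated by `s` that contains `s` is everything. -/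
theorem eq_top_of_subset_of_sup_mem {S : Submodule ℝ (vectorSublatticeClosure s)}
    (h1 : ∀ x (hx : x ∈ s), (⟨x, subset_vectorSublatticeClosure hx⟩ : vectorSublatticeClosure s) ∈ S)
    (h2 : ∀ x ∈ S, ∀ y ∈ S, x ⊔ y ∈ S) : S = ⊤ := by
  have hle : vectorSublatticeClosure s ≤ S.map (vectorSublatticeClosure s).subtype := by
    refine vectorSublatticeClosure_le (fun x hx => ⟨_, h1 x hx, rfl⟩) ?_
    rintro _ ⟨x, hx, rfl⟩ _ ⟨y, hy, rfl⟩
    exact ⟨x ⊔ y, h2 x hx y hy, rfl⟩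
  refine eq_top_iff.2 fun x _ => ?_
  obtain ⟨y, hy, hyx⟩ := hle x.2
  rwa [← Subtype.ext hyx]

/-- The principal ideal of `e` is a vector sublattice containing `s`; bounding both `x` and `-x`
makes it closed under negative scalars. -/
theorem exists_le_smul_of_mem_vectorSublatticeClosure {e : X} (he : 0 ≤ e)
    (hs : ∀ x ∈ s, ∃ c : ℝ, 0 ≤ c ∧ |x| ≤ c • e) {x : X} (hx : x ∈ vectorSublatticeClosure s) :
    ∃ c : ℝ, 0 ≤ c ∧ x ≤ c • e := by
  let I : Submodule ℝ X :=
    { carrier := {x | ∃ c : ℝ, 0 ≤ c ∧ x ≤ c • e ∧ -x ≤ c • e}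
      add_mem' := by
        rintro x y ⟨c, hc, h1, h2⟩ ⟨d, hd, h3, h4⟩
        refine ⟨c + d, add_nonneg hc hd, ?_, ?_⟩
        · rw [add_smul]; exact add_le_add h1 h3
        · rw [add_smul, neg_add]; exact add_le_add h2 h4
      zero_mem' := ⟨0, le_rfl, by simp, by simp⟩
      smul_mem' := by
        rintro a x ⟨c, hc, h1, h2⟩
        refine ⟨|a| * c, by positivity, ?_⟩
        rw [mul_smul]
        rcases le_total 0 a with ha | ha
        · rw [abs_of_nonneg ha, ← smul_neg]
          exact ⟨smul_le_smul_of_nonneg_left h1 ha, smul_le_smul_of_nonneg_left h2 ha⟩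
        · rw [abs_of_nonpos ha, ← neg_smul, show a • x = (-a) • -x by simp]
          exact ⟨smul_le_smul_of_nonneg_left h2 (neg_nonneg.2 ha),
            smul_le_smul_of_nonneg_left h1 (neg_nonneg.2 ha)⟩ }
  have hle : vectorSublatticeClosure s ≤ I := by
    refine vectorSublatticeClosure_le (fun x hx => ?_) ?_
    · obtain ⟨c, hc, h⟩ := hs x hx
      exact ⟨c, hc, (le_abs_self x).trans h, (neg_le_abs x).trans h⟩
    · rintro x ⟨c, hc, h1, h2⟩ y ⟨d, hd, h3, h4⟩
      have hcd : c • e ≤ (c + d) • e := smul_le_smul_of_nonneg_right (by linarith) he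
      have hdc : d • e ≤ (c + d) • e := smul_le_smul_of_nonneg_right (by linarith) he
      exact ⟨c + d, add_nonneg hc hd, sup_le (h1.trans hcd) (h3.trans hdc),
        (neg_le_neg le_sup_left).trans (h2.trans hcd)⟩
  obtain ⟨c, hc, h, -⟩ := hle hx
  exact ⟨c, hc, h⟩

end Sublattice

/-! ### The isometric lattice embedding -/

section Embedding

variable {X : Type w} [NormedAddCommGroup X] [NormedSpace ℝ X] [Lattice X] [IsBanachLattice X]

/-- The Archimedean property demanded by Yosida's theorem, from closedness of the order as `ε → 0`.
-/
theorem nonpos_of_forall_le_smul {e y : X} (h : ∀ ε : ℝ, 0 < ε → y ≤ ε • e) : y ≤ 0 := by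
  have h1 : Filter.Tendsto (fun ε : ℝ => ε • e) (nhdsWithin 0 (Set.Ioi 0)) (nhds ((0 : ℝ) • e)) :=
    ((continuous_id.smul continuous_const).tendsto 0).mono_left nhdsWithin_le_nhds
  rw [zero_smul] at h1
  exact ge_of_tendsto h1 (by filter_upwards [self_mem_nhdsWithin] with ε hε using h ε hε)

/-- Countably many elements of a Banach lattice lie in a common principal ideal. -/
theorem exists_common_order_unit (x : ℕ → X) :
    ∃ e : X, 0 ≤ e ∧ ‖e‖ ≤ 1 ∧ ∀ n, ∃ c : ℝ, 0 ≤ c ∧ |x n| ≤ c • e := by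
  -- The weights `1 / 2 / 2 ^ n` sum to `1`, which gives `‖e‖ ≤ 1`; the other factor compensates for
  -- the size of `x n`.
  let a : ℕ → ℝ := fun n => 1 / 2 / 2 ^ n * (1 + ‖x n‖)⁻¹
  have ha : ∀ n, 0 < a n := fun n => by positivity
  let y : ℕ → X := fun n => a n • |x n|
  have hy0 : ∀ n, 0 ≤ y n := fun n => smul_nonneg (ha n).le (abs_nonneg _)
  have hy : ∀ n, ‖y n‖ ≤ 1 / 2 / 2 ^ n := by
    intro n
    have h1 : (1 + ‖x n‖)⁻¹ * ‖x n‖ ≤ 1 := by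
      rw [inv_mul_le_iff₀ (by positivity)]
      linarith
    simp only [y, a]
    rw [norm_smul, norm_abs_eq_norm, Real.norm_of_nonneg (ha n).le, mul_assoc]
    exact mul_le_of_le_one_right (by positivity) h1
  have hsum := hasSum_geometric_two' (1 : ℝ)
  have hsummable : Summable y := Summable.of_norm_bounded hsum.summable hy
  refine ⟨∑' n, y n, tsum_nonneg hy0, tsum_of_norm_bounded hsum hy, fun n =>
    ⟨(a n)⁻¹, (inv_pos.2 (ha n)).le, ?_⟩⟩
  have h1 : y n ≤ ∑' n, y n := hsummable.le_tsum n fun m _ => hy0 m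
  have h2 := smul_le_smul_of_nonneg_left h1 (inv_pos.2 (ha n)).le
  rwa [inv_smul_smul₀ (ha n).ne'] at h2

/-- A separable Banach lattice has a dense subspace with an isometric lattice embedding into
`C(Δ, L₁[0,1])`. -/
theorem exists_dense_isometric_embedding [TopologicalSpace.SeparableSpace X] [Nontrivial X] :
    ∃ s : Set X, Dense (vectorSublatticeClosure s : Set X) ∧
      ∃ T : vectorSublatticeClosure s →ₗ[ℝ] CantorL1,
        (∀ x y, T (x ⊔ y) = T x ⊔ T y) ∧ ∀ x, ‖T x‖ = ‖x‖ := by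
  let x := TopologicalSpace.denseSeq X
  obtain ⟨e, he0, he1, hxe⟩ := exists_common_order_unit x
  let s : Set X := insert e (Set.range x)
  let V := vectorSublatticeClosure s
  have hxs : ∀ n, x n ∈ V := fun n => subset_vectorSublatticeClosure (Or.inr ⟨n, rfl⟩)
  have hes : e ∈ V := subset_vectorSublatticeClosure (Or.inl rfl)
  have hdense : Dense (V : Set X) :=
    (TopologicalSpace.denseRange_denseSeq X).mono (by rintro _ ⟨n, rfl⟩; exact hxs n)
  have hene : ¬ e ≤ 0 := by
    intro h
    obtain rfl : e = 0 := le_antisymm h he0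
    obtain ⟨y, hy⟩ := exists_ne (0 : X)
    refine hy ?_
    have hx0 : ∀ n, x n = 0 := fun n => by
      obtain ⟨c, -, hc⟩ := hxe n
      rw [smul_zero] at hc
      have h1 : |x n| = 0 := le_antisymm hc (abs_nonneg _)
      rw [← norm_eq_zero, ← norm_abs_eq_norm, h1, norm_zero]
    have hcl := TopologicalSpace.denseRange_denseSeq X y
    rw [show Set.range (TopologicalSpace.denseSeq X) = {0} from
      Set.eq_singleton_iff_unique_mem.2 ⟨⟨0, hx0 0⟩, by rintro _ ⟨n, rfl⟩; exact hx0 n⟩,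
      closure_singleton] at hcl
    exact hcl
  let e' : V := ⟨e, hes⟩
  have hs : ∀ y ∈ s, ∃ c : ℝ, 0 ≤ c ∧ |y| ≤ c • e := by
    rintro y (rfl | ⟨n, rfl⟩)
    · exact ⟨1, zero_le_one, by rw [abs_of_nonneg he0, one_smul]⟩
    · exact hxe n
  obtain ⟨J, hJsup, hJe, hJ⟩ := exists_cantorSet_representation (V := V) (e := e') he0 hene
    (fun y => exists_le_smul_of_mem_vectorSublatticeClosure he0 hs y.2)
    (fun y hy => nonpos_of_forall_le_smul (X := X) (e := e) hy) (fun n => ⟨x n, hxs n⟩) (by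
      intro ω₁ ω₂ h₁ h₂ h₁e h₂e hω
      -- The equalizer of two lattice homomorphisms is a vector sublattice containing the
      -- generators, so the sequence `x` separates the spectrum.
      have htop : LinearMap.eqLocus ω₁ ω₂ = ⊤ := by
        refine eq_top_of_subset_of_sup_mem ?_ ?_
        · rintro y (rfl | ⟨n, rfl⟩)
          · exact h₁e.trans h₂e.symm
          · exact hω n
        · intro y hy z hz
          rw [LinearMap.mem_eqLocus] at *
          rw [h₁, h₂, hy, hz]
      exact LinearMap.eqLocus_eq_top.1 htop)
  obtain ⟨ν, hν0, hν1, hνc, hνJ, hνn⟩ :=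
    exists_cantorSet_norming_family (V := V) (e := e') hJsup hJe he1 hJ
  obtain ⟨T, hTsup, hTn⟩ := exists_latticeHom_L1_of_family ν hν0 hν1 hνc
  refine ⟨s, hdense, T ∘ₗ J, fun y z => ?_, fun y => ?_⟩
  · simp only [LinearMap.comp_apply]
    rw [hJsup, hTsup]
  · refine le_antisymm ((ContinuousMap.norm_le _ (norm_nonneg _)).2 fun z => ?_) ?_
    · have hJabs : |J y| = J |y| := by rw [abs, abs, hJsup, map_neg]
      rw [LinearMap.comp_apply, hTn, hJabs]
      exact (hνJ z _).trans_eq (norm_abs_eq_norm y)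
    · obtain ⟨z, hz⟩ := hνn y
      rw [← hz, ← hTn]
      exact ContinuousMap.norm_coe_le_norm (T (J y)) z

theorem isLatticeHomomorphism_of_map_sup {Y : Type v} [NormedAddCommGroup Y] [NormedSpace ℝ Y]
    [Lattice Y] [IsBanachLattice Y] {T : X →L[ℝ] Y} (h : ∀ x y, T (x ⊔ y) = T x ⊔ T y) :
    IsLatticeHomomorphism T := by
  refine ⟨h, fun x y => ?_⟩
  rw [← neg_neg (x ⊓ y), neg_inf, map_neg, h, neg_sup, map_neg, map_neg, neg_neg, neg_neg]

/-- Every separable Banach lattice embeds lattice isometrically into `C(Δ, L₁[0,1])`. -/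
theorem exists_isLatticeIsometricEmbedding_cantorL1 [TopologicalSpace.SeparableSpace X] :
    ∃ T : X →L[ℝ] CantorL1, IsLatticeIsometricEmbedding T := by
  rcases subsingleton_or_nontrivial X with hX | hX
  -- In the trivial space no order unit is nonzero, so this case is separate.
  · exact ⟨0, fun x y => by rw [Subsingleton.elim x y]; simp, fun x y => by simp,
      fun x y => by simp⟩
  obtain ⟨s, hs, T₀, hT₀sup, hT₀n⟩ := exists_dense_isometric_embedding (X := X)
  let V := vectorSublatticeClosure s
  let f : V →ₗᵢ[ℝ] CantorL1 := ⟨T₀, hT₀n⟩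
  let T : X →L[ℝ] CantorL1 := f.toContinuousLinearMap.extend V.subtypeL
  have hdr : DenseRange V.subtypeL := by
    rw [DenseRange]
    simpa using hs
  have hT : ∀ x : V, T x = T₀ x := fun x =>
    ContinuousLinearMap.extend_eq f.toContinuousLinearMap hdr
      isUniformEmbedding_subtype_val.isUniformInducing x
  refine ⟨T, ?_, isLatticeHomomorphism_of_map_sup fun x y => ?_⟩
  · refine AddMonoidHomClass.isometry_of_norm T fun x => ?_
    refine hdr.induction_on x (isClosed_eq (by fun_prop) (by fun_prop)) fun y => ?_
    exact (congrArg norm (hT y)).trans (hT₀n y)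
  · refine hdr.induction_on₂ (p := fun x y => T (x ⊔ y) = T x ⊔ T y)
      (isClosed_eq (by fun_prop) (by fun_prop)) (fun y z => ?_) x y
    exact (hT (y ⊔ z)).trans ((hT₀sup y z).trans (congrArg₂ _ (hT y).symm (hT z).symm))

end Embedding

theorem mainTheorem10 :
    (∀ (X : Type u) [NormedAddCommGroup X] [NormedSpace ℝ X] [Lattice X] [IsBanachLattice X]
        (K : Type v) [TopologicalSpace K] [CompactSpace K] [T2Space K],
        RealLatticeHom X = {0} → RealLatticeHom C(K, X) = {0}) ∧
      IsBanachLattice CantorL1 ∧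
      RealLatticeHom CantorL1 = {0} ∧
      (∀ (X : Type w) [NormedAddCommGroup X] [NormedSpace ℝ X] [Lattice X] [IsBanachLattice X]
        [TopologicalSpace.SeparableSpace X],
        ∃ T : X →L[ℝ] CantorL1, IsLatticeIsometricEmbedding T) :=
  ⟨fun _ _ _ _ _ _ _ _ _ h => realLatticeHom_continuousMap_eq_zero h, inferInstance,
    realLatticeHom_continuousMap_eq_zero realLatticeHom_L1Interval_eq_zero,
    fun _ _ _ _ _ _ => exists_isLatticeIsometricEmbedding_cantorL1⟩
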